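/- **Theorem.** Coordinates on \(\mathbb R^3\) are written \((x,y,z)\). A *Lie algebra of vector fields* on an open set \(U\subset\mathbb R^3\) is a real Lie algebra of \(C^\infty\) vector fields on \(U\); the *rank* of a space \(S\) of vector fields on \(U\) is \(\max_{p\in U}\dim\{v(p): v\in S\}\), and \(Z(\mathfrak g)\) denotes the center of \(\mathfrak g\). **(a)** Let \(\mathfrak g\) be a finite-dimensional nonabelian nilpotent Lie algebra of vector fields on \(U\) such that no nonzero element of \(\mathfrak g\) vanishes identically on a nonempty open subset of \(U\). Suppose that \(Z(\mathfrak g)\) has rank one and \(\dim Z(\mathfrak g)\ge 2\). Then every nonempty open subset of \(U\) contains a nonempty open set with \(C^\infty\) coordinates \((x,y,z)\) on it in which every element of \(\mathfrak g\) has the form \(f(y)\partial_x+g(x,y)\partial_z\) with \(f,g\) smooth, and in which \(\partial_x\in\mathfrak g\) and \(\partial_z\in Z(\mathfrak g)\). **(b)** Conversely, let \(U\subset\mathbb R^3\) be open and let \(J\subset\mathbb R\) be the set of values of \(y\) on \(U\). Let \(f_1,\dots,f_m\) be smooth functions of \(y\in J\), and let \(h_1,\dots,h_m,g_1,\dots,g_n\)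 be polynomials in \(x\) whose coefficients are smooth functions of \(y\in J\) (\(m,n\ge 0\)). Let \(\mathfrak g\) be the Lie algebra of vector fields on \(U\) generated by \(\partial_x\), \(\partial_z\), the lifts \(f_i(y)\partial_x+h_i(x,y)\partial_z\) of the fields \(f_i(y)\partial_x\) \((1\le i\le m)\), and the fields \(g_j(x,y)\partial_z\) \((1\le j\le n)\). Then \(\mathfrak g\) is finite-dimensional and nilpotent, and it is nonabelian if and only if at least one of the \(h_i\), \(g_j\) has positive degree in \(x\). If one of the \(g_j\) has positive degree in \(x\), and if moreover some \(f_i\) is not constant or some \(g_j\) has a nonconstant leading coefficient with respect to \(x\), then \(\dim Z(\mathfrak g)\ge 2\). If \(\mathfrak g\) is nonabelian, and no linear combination of \(1,f_1,\dots,f_m\) that is not identically zero on \(J\) vanishes identically on a nonempty open subset of \(J\), then \(Z(\mathfrak g)\) has rank one. **(c)** Under the assumptions of the last sentence of (b), every element of \(Z(\mathfrak g)\) is of the form \(k(y)\partial_z\) with \(k\) smooth on \(J\). -/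

import Mathlib

open scoped ContDiff

noncomputable section

/-- Three-dimensional space; a point is written `p = (x, y, z)`, so that `x = p.1`, `y = p.2.1`
and `z = p.2.2`. -/
abbrev R3 : Type := ℝ × ℝ × ℝ

/-- The `C^∞` vector fields on the open set `U`, as a real vector space. A vector field is a map
`R3 → R3` that is smooth on `U`; it is normalised to be `0` outside `U`, so that two fields are
equal exactly when they agree on `U`. -/
def vectorFields (U : TopologicalSpace.Opens R3) : Submodule ℝ (R3 → R3) where
  carrier := {X | ContDiffOn ℝ ∞ X U ∧ ∀ p ∉ U, X p = 0}
  add_mem' := fun {X Y} hX hY =>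
    ⟨hX.1.add hY.1, fun p hp => by simp [hX.2 p hp, hY.2 p hp]⟩
  zero_mem' := ⟨contDiffOn_const, fun _ _ => rfl⟩
  smul_mem' := fun c X hX => ⟨contDiffOn_const.smul hX.1, fun p hp => by simp [hX.2 p hp]⟩

/-- The type of `C^∞` vector fields on the open set `U`. -/
abbrev VF (U : TopologicalSpace.Opens R3) : Type := vectorFields U

namespace VF

variable {U : TopologicalSpace.Opens R3}

theorem contDiffAt (X : VF U) {p : R3} (hp : p ∈ U) : ContDiffAt ℝ ∞ X.1 p :=
  X.2.1.contDiffAt (U.isOpen.mem_nhds hp)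

theorem differentiableAt (X : VF U) {p : R3} (hp : p ∈ U) : DifferentiableAt ℝ X.1 p :=
  (X.contDiffAt hp).differentiableAt (by simp)

/-- The field on `U` given by a map that is smooth on `U`. -/
def ofFun (Y : R3 → R3) (hY : ContDiffOn ℝ ∞ Y U) : VF U :=
  ⟨(U : Set R3).indicator Y,
    hY.congr fun _ hp => Set.indicator_of_mem hp Y,
    fun _ hp => Set.indicator_of_notMem hp Y⟩

theorem ofFun_apply (Y : R3 → R3) (hY : ContDiffOn ℝ ∞ Y U) {p : R3} (hp : p ∈ U) :
    (ofFun Y hY).1 p = Y p :=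
  Set.indicator_of_mem hp Y

theorem ext_on {X Y : VF U} (h : ∀ p ∈ U, X.1 p = Y.1 p) : X = Y := by
  apply Subtype.ext
  funext p
  by_cases hp : p ∈ U
  · exact h p hp
  · rw [X.2.2 p hp, Y.2.2 p hp]

theorem contDiffOn_lieBracket (X Y : VF U) :
    ContDiffOn ℝ ∞ (VectorField.lieBracket ℝ X.1 Y.1) U := fun _ hp =>
  ((X.contDiffAt hp).lieBracket_vectorField (Y.contDiffAt hp) (by simp)).contDiffWithinAt

/-- The Lie bracket of vector fields, `[X, Y] = DY(X) - DX(Y)`. -/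
instance : Bracket (VF U) (VF U) where
  bracket X Y := ofFun (VectorField.lieBracket ℝ X.1 Y.1) (contDiffOn_lieBracket X Y)

theorem bracket_apply (X Y : VF U) {p : R3} (hp : p ∈ U) :
    (⁅X, Y⁆ : VF U).1 p = VectorField.lieBracket ℝ X.1 Y.1 p :=
  ofFun_apply _ _ hp

theorem bracket_eventuallyEq (X Y : VF U) {p : R3} (hp : p ∈ U) :
    (⁅X, Y⁆ : VF U).1 =ᶠ[nhds p] VectorField.lieBracket ℝ X.1 Y.1 :=
  Filter.eventuallyEq_of_mem (U.isOpen.mem_nhds hp) fun _ hq => bracket_apply X Y hq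

instance : LieRing (VF U) where
  add_lie X Y Z := ext_on fun p hp => by
    rw [bracket_apply _ _ hp]
    change VectorField.lieBracket ℝ (X.1 + Y.1) Z.1 p = (⁅X, Z⁆ : VF U).1 p + (⁅Y, Z⁆ : VF U).1 p
    rw [bracket_apply _ _ hp, bracket_apply _ _ hp,
      VectorField.lieBracket_add_left (X.differentiableAt hp) (Y.differentiableAt hp)]
  lie_add X Y Z := ext_on fun p hp => by
    rw [bracket_apply _ _ hp]
    change VectorField.lieBracket ℝ X.1 (Y.1 + Z.1) p = (⁅X, Y⁆ : VF U).1 p + (⁅X, Z⁆ : VF U).1 p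
    rw [bracket_apply _ _ hp, bracket_apply _ _ hp,
      VectorField.lieBracket_add_right (Y.differentiableAt hp) (Z.differentiableAt hp)]
  lie_self X := ext_on fun p hp => by
    rw [bracket_apply _ _ hp, VectorField.lieBracket_self]
    rfl
  leibniz_lie X Y Z := ext_on fun p hp => by
    rw [bracket_apply _ _ hp]
    change _ = (⁅⁅X, Y⁆, Z⁆ : VF U).1 p + (⁅Y, ⁅X, Z⁆⁆ : VF U).1 p
    rw [bracket_apply _ _ hp, bracket_apply _ _ hp,
      Filter.EventuallyEq.lieBracket_vectorField_eq (Filter.EventuallyEq.refl _ X.1)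
        (bracket_eventuallyEq Y Z hp),
      Filter.EventuallyEq.lieBracket_vectorField_eq (bracket_eventuallyEq X Y hp)
        (Filter.EventuallyEq.refl _ Z.1),
      Filter.EventuallyEq.lieBracket_vectorField_eq (Filter.EventuallyEq.refl _ Y.1)
        (bracket_eventuallyEq X Z hp)]
    exact VectorField.leibniz_identity_lieBracket (n := ∞)
      (by rw [minSmoothness_of_isRCLikeNormedField]; exact WithTop.coe_le_coe.2 le_top)
      (X.contDiffAt hp) (Y.contDiffAt hp) (Z.contDiffAt hp)

instance : LieAlgebra ℝ (VF U) where
  lie_smul c X Y := ext_on fun p hp => by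
    rw [bracket_apply _ _ hp]
    change VectorField.lieBracket ℝ X.1 (c • Y.1) p = c • (⁅X, Y⁆ : VF U).1 p
    rw [bracket_apply _ _ hp, VectorField.lieBracket_const_smul_right (Y.differentiableAt hp)]

/-- The value of a vector field at a point, as a linear map of the field. -/
def evalAt (p : R3) : VF U →ₗ[ℝ] R3 := (LinearMap.proj p).comp (vectorFields U).subtype

/-- The rank of a space of vector fields: the maximum over `p ∈ U` of `dim {v(p) | v ∈ S}`
(all these dimensions are at most `3`; the value is `0` if `U` is empty). -/
def rank (S : Submodule ℝ (VF U)) : ℕ := ⨆ p : U, Module.finrank ℝ (S.map (evalAt p.1))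

/-- The center of a Lie algebra of vector fields, as a space of vector fields. -/
def center (g : LieSubalgebra ℝ (VF U)) : Submodule ℝ (VF U) :=
  (LieAlgebra.center ℝ g).toSubmodule.map (g.incl : g →ₗ[ℝ] VF U)

/-- Restriction of `g` to any nonempty open subset of `U` is injective. -/
def LocallyFaithful (g : LieSubalgebra ℝ (VF U)) : Prop :=
  ∀ X ∈ g, ∀ W : Set R3, IsOpen W → W.Nonempty → W ⊆ U → (∀ p ∈ W, X.1 p = 0) → X = 0

/-- In the coordinates `φ = (x, y, z)` on `φ.source`, the vector field `X` is `Y`. -/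
def HasExpression (φ : OpenPartialHomeomorph R3 R3) (X : VF U) (Y : R3 → R3) : Prop :=
  ∀ p ∈ φ.source, fderiv ℝ φ p (X.1 p) = Y (φ p)

end VF

/-- `φ` is a `C^∞` coordinate system on its source. -/
def IsSmoothChart (φ : OpenPartialHomeomorph R3 R3) : Prop :=
  ContDiffOn ℝ ∞ φ φ.source ∧ ContDiffOn ℝ ∞ φ.symm φ.target

/-- The set of values of the coordinate `y` on `V`. -/
def yRange (V : Set R3) : Set ℝ := (fun p : R3 => p.2.1) '' V

/-- The set of values of the coordinates `(x, y)` on `V`. -/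
def xyRange (V : Set R3) : Set (ℝ × ℝ) := (fun p : R3 => (p.1, p.2.1)) '' V

/-- `Y` has the form `f(y) ∂_x + g(x, y) ∂_z` on `V`, with smooth `f` and `g`. -/
def IsTriangularOn (V : Set R3) (Y : R3 → R3) : Prop :=
  ∃ (f : ℝ → ℝ) (g : ℝ × ℝ → ℝ), ContDiffOn ℝ ∞ f (yRange V) ∧ ContDiffOn ℝ ∞ g (xyRange V) ∧
    ∀ p ∈ V, Y p = (f p.2.1, 0, g (p.1, p.2.1))

/-- The value at `(x, y)` of a polynomial in `x` whose coefficients are functions of `y`. -/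
def polyEval (P : Polynomial (ℝ → ℝ)) (x y : ℝ) : ℝ := P.sum fun k c => c y * x ^ k

/-- The coefficients of `P` are smooth functions of `y ∈ J`. -/
def SmoothCoeffs (J : Set ℝ) (P : Polynomial (ℝ → ℝ)) : Prop :=
  ∀ k, ContDiffOn ℝ ∞ (P.coeff k) J

/-- Over `J`, the polynomial `P` has positive degree in `x`. -/
def PosDegree (J : Set ℝ) (P : Polynomial (ℝ → ℝ)) : Prop :=
  ∃ k, 1 ≤ k ∧ ∃ y ∈ J, P.coeff k y ≠ 0

/-- The function `f` is not constant on `J`. -/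
def NonconstantOn (J : Set ℝ) (f : ℝ → ℝ) : Prop := ∃ y ∈ J, ∃ y' ∈ J, f y ≠ f y'

/-- Over `J`, the leading coefficient of `P` (with respect to `x`) is a nonconstant function
of `y`. -/
def NonconstantLeadingCoeff (J : Set ℝ) (P : Polynomial (ℝ → ℝ)) : Prop :=
  ∃ k, (∀ l, k < l → ∀ y ∈ J, P.coeff l y = 0) ∧ NonconstantOn J (P.coeff k)

theorem contDiffOn_triangular {V : Set R3} {f : ℝ → ℝ} {P : Polynomial (ℝ → ℝ)}
    (hf : ContDiffOn ℝ ∞ f (yRange V)) (hP : SmoothCoeffs (yRange V) P) :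
    ContDiffOn ℝ ∞ (fun p : R3 => ((f p.2.1, 0, polyEval P p.1 p.2.1) : R3)) V := by
  have hy : ContDiff ℝ ∞ (fun p : R3 => p.2.1) := contDiff_fst.comp contDiff_snd
  have hm : Set.MapsTo (fun p : R3 => p.2.1) V (yRange V) := Set.mapsTo_image _ _
  refine (hf.comp hy.contDiffOn hm).prodMk (contDiffOn_const.prodMk ?_)
  unfold polyEval Polynomial.sum
  exact ContDiffOn.sum fun k _ =>
    ((hP k).comp hy.contDiffOn hm).mul (contDiff_fst.pow k).contDiffOn

namespace VF

variable {U : TopologicalSpace.Opens R3}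

/-- The coordinate vector field `∂_x` on `U`. -/
def dx (U : TopologicalSpace.Opens R3) : VF U := ofFun (fun _ => (1, 0, 0)) contDiffOn_const

/-- The coordinate vector field `∂_z` on `U`. -/
def dz (U : TopologicalSpace.Opens R3) : VF U := ofFun (fun _ => (0, 0, 1)) contDiffOn_const

/-- The vector field `f(y) ∂_x + P(x, y) ∂_z` on `U`, with `P` polynomial in `x`: a lift of
`f(y) ∂_x`. -/
def lift {f : ℝ → ℝ} {P : Polynomial (ℝ → ℝ)} (hf : ContDiffOn ℝ ∞ f (yRange (U : Set R3)))
    (hP : SmoothCoeffs (yRange (U : Set R3)) P) : VF U :=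
  ofFun (fun p => (f p.2.1, 0, polyEval P p.1 p.2.1)) (contDiffOn_triangular hf hP)

/-- The vector field `P(x, y) ∂_z` on `U`, with `P` polynomial in `x`. -/
def vertical {P : Polynomial (ℝ → ℝ)} (hP : SmoothCoeffs (yRange (U : Set R3)) P) : VF U :=
  lift (f := fun _ => 0) contDiffOn_const hP

/-- The Lie algebra of vector fields on `U` generated by `∂_x`, `∂_z`, the lifts
`f_i(y) ∂_x + h_i(x, y) ∂_z` and the fields `g_j(x, y) ∂_z`. -/
def generated {m n : ℕ} {f : Fin m → ℝ → ℝ} {h : Fin m → Polynomial (ℝ → ℝ)}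
    {g : Fin n → Polynomial (ℝ → ℝ)}
    (hf : ∀ i, ContDiffOn ℝ ∞ (f i) (yRange (U : Set R3)))
    (hh : ∀ i, SmoothCoeffs (yRange (U : Set R3)) (h i))
    (hg : ∀ j, SmoothCoeffs (yRange (U : Set R3)) (g j)) : LieSubalgebra ℝ (VF U) :=
  LieSubalgebra.lieSpan ℝ (VF U)
    ({dx U, dz U} ∪ Set.range (fun i => lift (hf i) (hh i)) ∪ Set.range (fun j => vertical (hg j)))

end VF

end

/-!
The normal form (a). A central field `Z ≠ 0` and a second, independent central field `Z₁ = k Z`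
give a function `k` that every `X ∈ g` annihilates, because `0 = [X, k Z] = X(k) Z`; by local
faithfulness `k` is not locally constant, so all of `g` is tangent to the surfaces `k = const` on
an open set where `dk ≠ 0`. The fields of `g` proportional to `Z` there commute with each other, so
they are not all of `g`; the last term of the lower central series not contained in them yields
`X₀ ∈ g`, independent of `Z` at some point, such that `[X₀, X]` is proportional to `Z` for all
`X ∈ g` (`VF.exists_notMem_forall_bracket_mem`). Now `X₀` and `Z` are a commuting frame of the
leaves `k = const`, and they can be made `∂_x` and `∂_z` without solving a differential equation:
the one-forms dual to `X₀`, `Z` on the leaves are closed, so they are differentials `dx`, `dz` of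
functions that depend smoothly on the leaf (`exists_leafwise_potential`,
`exists_dual_coordinate`), and `(x, k, z)` is a chart. In it, `Z` commutes with `X`, so the
components of `X` do not depend on `z`, and `[X₀, X]` has no `∂_x`-component, so the
`∂_x`-component of `X` depends on `y` alone.

The converse (b), (c). Fields `F(y) ∂_x + P(x, y) ∂_z` with `P` polynomial in `x` satisfy
`[F ∂_x + P ∂_z, G ∂_x + Q ∂_z] = (F Q_x - G P_x) ∂_z`. Brackets therefore lower the degree in
`x`, which gives nilpotency, and the coefficients of all iterated brackets stay in
finite-dimensional spaces of products of the `f_i` with the given coefficients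
(`VF.finiteDimensional_generated`). Repeated brackets of `g_j ∂_z` with `∂_x`, and possibly one with
`f_i ∂_x + h_i ∂_z`, end in nonconstant multiples `κ(y) ∂_z`, which are central. Conversely a
central field commutes with `∂_x`, hence `P_x = 0`, and with a field depending on `x`, which
forces `F` to vanish on an open set and so identically.
-/

/-! ### Parametric antiderivatives and the leafwise Poincaré lemma -/

/-- Differentiation under the integral sign, in the form of smoothness in the parameters. -/
theorem contDiff_integral_of_contDiff {E : Type} [NormedAddCommGroup E] [NormedSpace ℝ E]
    [FiniteDimensional ℝ E] (n : ℕ) :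
    ∀ {G : Type} [NormedAddCommGroup G] [NormedSpace ℝ G] [CompleteSpace G] {f : E × ℝ → G},
      ContDiff ℝ n f → ContDiff ℝ n fun x => ∫ t in (0 : ℝ)..1, f (x, t) := by
  induction n with
  | zero =>
    intro G _ _ _ f hf
    simp only [CharP.cast_eq_zero, contDiff_zero] at hf ⊢
    exact intervalIntegral.continuous_parametric_intervalIntegral_of_continuous'
      (f := fun x t => f (x, t)) hf 0 1
  | succ n ih =>
    intro G _ _ _ f hf
    have hdf : ContDiff ℝ n fun q : E × ℝ =>
        (fderiv ℝ f q).comp (ContinuousLinearMap.inl ℝ E ℝ) :=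
      (hf.fderiv_right (m := n) (by norm_cast)).clm_comp contDiff_const
    have hd : ∀ x : E, HasFDerivAt (fun x => ∫ t in (0 : ℝ)..1, f (x, t))
        (∫ t in (0 : ℝ)..1, (fderiv ℝ f (x, t)).comp (ContinuousLinearMap.inl ℝ E ℝ)) x := by
      intro x
      have hK : IsCompact (Metric.closedBall x 1 ×ˢ Set.Icc (0 : ℝ) 1) :=
        (isCompact_closedBall x 1).prod isCompact_Icc
      obtain ⟨M, hM⟩ := hK.exists_bound_of_continuousOn hdf.continuous.continuousOn
      refine intervalIntegral.hasFDerivAt_integral_of_dominated_of_fderiv_le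
        (F' := fun x t => (fderiv ℝ f (x, t)).comp (ContinuousLinearMap.inl ℝ E ℝ))
        (bound := fun _ => M) (Metric.closedBall_mem_nhds x one_pos) ?_ ?_ ?_ ?_ ?_ ?_
      · exact .of_forall fun y => ((hf.continuous.comp
          (Continuous.prodMk_right y)).aestronglyMeasurable)
      · exact (hf.continuous.comp (Continuous.prodMk_right x)).intervalIntegrable _ _
      · exact (hdf.continuous.comp (Continuous.prodMk_right x)).aestronglyMeasurable
      · refine .of_forall fun t ht y hy => hM (y, t) ⟨hy, ?_⟩
        rw [Set.uIoc_of_le zero_le_one] at ht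
        exact ⟨ht.1.le, ht.2⟩
      · simp
      · refine .of_forall fun t _ y _ => ?_
        have h1 : HasFDerivAt f (fderiv ℝ f (y, t)) (y, t) :=
          (hf.differentiable (by simp) (y, t)).hasFDerivAt
        exact h1.comp y (hasFDerivAt_prodMk_left y t)
    rw [show ((n + 1 : ℕ) : WithTop ℕ∞) = (n : WithTop ℕ∞) + 1 by norm_cast,
      contDiff_succ_iff_fderiv]
    refine ⟨fun x => (hd x).differentiableAt, by simp, ?_⟩
    rw [funext fun x => (hd x).fderiv]
    exact ih hdf

/-- A smooth function has a smooth antiderivative along a direction `e`. -/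
theorem exists_contDiff_fderiv_apply_eq {E : Type} [NormedAddCommGroup E] [NormedSpace ℝ E]
    [FiniteDimensional ℝ E] {f : E → ℝ} (hf : ContDiff ℝ ∞ f) {e : E} (l : E →L[ℝ] ℝ)
    (hl : l e = 1) :
    ∃ C : E → ℝ, ContDiff ℝ ∞ C ∧ ∀ p, fderiv ℝ C p e = f p := by
  have hint : ContDiff ℝ ∞ fun p => ∫ t in (0 : ℝ)..1, f (p - l p • e + (t * l p) • e) := by
    refine contDiff_infty.2 fun n => contDiff_integral_of_contDiff n
      (f := fun q : E × ℝ => f (q.1 - l q.1 • e + (q.2 * l q.1) • e)) ?_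
    refine (hf.of_le (by exact_mod_cast le_top)).comp ?_
    fun_prop
  have hC : ContDiff ℝ ∞ fun p => l p * ∫ t in (0 : ℝ)..1, f (p - l p • e + (t * l p) • e) :=
    l.contDiff.mul hint
  refine ⟨_, hC, fun p => ?_⟩
  have h1 := ((hC.differentiable (by simp) p).hasFDerivAt).comp_hasDerivAt_of_eq (0 : ℝ)
    (((hasDerivAt_id (0 : ℝ)).smul_const e).const_add p) (by simp)
  simp only [one_smul] at h1
  have hcont : Continuous fun r : ℝ => f (p - l p • e + r • e) := by
    have := hf.continuous
    fun_prop
  have h2 : HasDerivAt (fun t : ℝ => ∫ r in (0 : ℝ)..(l p + t), f (p - l p • e + r • e))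
      (f p) 0 := by
    have := intervalIntegral.integral_hasDerivAt_right (hcont.intervalIntegrable 0 (l p))
      (hcont.stronglyMeasurableAtFilter _ _) hcont.continuousAt
    have h3 := this.comp_of_eq (0 : ℝ) ((hasDerivAt_id (0 : ℝ)).const_add (l p)) (by simp)
    simpa [Function.comp_def] using h3
  refine h1.unique (h2.congr_of_eventuallyEq (.of_forall fun t => ?_))
  -- on the line through `p`, rescaling turns the integral over `[0, 1]` into one over `[0, l p + t]`
  have := intervalIntegral.mul_integral_comp_mul_right (a := 0) (b := 1)
    (f := fun r => f (p - l p • e + r • e)) (l p + t)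
  simp only [zero_mul, one_mul] at this
  simp only [Function.comp_apply, id_eq]
  rw [← this]
  simp only [map_add, map_smul, hl, smul_eq_mul, mul_one]
  congr 2 with r
  congr 1
  module

/-- A function smooth near `p` agrees near `p` with a globally smooth one. -/
theorem exists_contDiff_eqOn_ball {E : Type} [NormedAddCommGroup E] [NormedSpace ℝ E]
    [FiniteDimensional ℝ E] {V : Set E} (hV : IsOpen V) {p : E} (hp : p ∈ V) {f : E → ℝ}
    (hf : ContDiffOn ℝ ∞ f V) :
    ∃ g : E → ℝ, ContDiff ℝ ∞ g ∧ ∃ r > 0, Metric.ball p r ⊆ V ∧ Set.EqOn g f (Metric.ball p r) := by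
  obtain ⟨R, hR, hRV⟩ := Metric.nhds_basis_closedBall.mem_iff.1 (hV.mem_nhds hp)
  let b : ContDiffBump p := ⟨R / 2, R, by positivity, by linarith⟩
  refine ⟨fun q => b q * f q, contDiff_iff_contDiffAt.2 fun q => ?_, R / 2, by positivity,
    (Metric.ball_subset_closedBall.trans (Metric.closedBall_subset_closedBall (by linarith))).trans
      hRV, fun q hq => ?_⟩
  · by_cases hq : q ∈ Metric.closedBall p R
    · exact b.contDiff.contDiffAt.mul (hf.contDiffAt (hV.mem_nhds (hRV hq)))
    · refine contDiffAt_const (c := (0 : ℝ)) |>.congr_of_eventuallyEq ?_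
      filter_upwards [Metric.isClosed_closedBall.isOpen_compl.mem_nhds hq] with y hy
      have hy' : R < dist y p := by simpa using hy
      rw [b.zero_of_le_dist hy'.le, zero_mul]
  · simp [b.one_of_mem_closedBall (Metric.ball_subset_closedBall hq)]

/-- A function on a convex open set with vanishing derivative along `e` is constant along `e`. -/
theorem eq_of_fderiv_apply_eq_zero {E : Type} [NormedAddCommGroup E] [NormedSpace ℝ E]
    {B : Set E} (hB : Convex ℝ B) (hBo : IsOpen B) {f : E → ℝ} (hf : DifferentiableOn ℝ f B)
    {e : E} (h0 : ∀ q ∈ B, fderiv ℝ f q e = 0) {q : E} (hq : q ∈ B) {t : ℝ}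
    (ht : q + t • e ∈ B) : f (q + t • e) = f q := by
  have hmem : ∀ s ∈ Set.Icc (0 : ℝ) 1, q + (s * t) • e ∈ B := fun s hs => by
    have := hB.add_smul_mem hq ht hs
    rwa [mul_smul]
  have hd : ∀ s ∈ Set.Icc (0 : ℝ) 1, HasDerivAt (fun s : ℝ => f (q + (s * t) • e)) 0 s := by
    intro s hs
    have h1 := ((hf.differentiableAt (hBo.mem_nhds (hmem s hs))).hasFDerivAt).comp_hasDerivAt s
      ((((hasDerivAt_id s).mul_const t).smul_const e).const_add q)
    simpa [Function.comp_def, h0 _ (hmem s hs)] using h1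
  have := constant_of_has_deriv_right_zero
    (fun s hs => (hd s hs).continuousAt.continuousWithinAt)
    (fun s hs => (hd s ⟨hs.1, hs.2.le⟩).hasDerivWithinAt) 1 ⟨zero_le_one, le_rfl⟩
  simpa using this

/-- The Poincaré lemma on the leaves `y = const`, with smooth dependence on `y`: a form
`a dx + b dz` that is closed along the leaves has a smooth local potential. -/
theorem exists_leafwise_potential {T : Set R3} (hT : IsOpen T) {q₀ : R3} (hq₀ : q₀ ∈ T)
    {a b : R3 → ℝ} (ha : ContDiffOn ℝ ∞ a T) (hb : ContDiffOn ℝ ∞ b T)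
    (hab : ∀ q ∈ T, fderiv ℝ a q (0, 0, 1) = fderiv ℝ b q (1, 0, 0)) :
    ∃ T' : Set R3, IsOpen T' ∧ q₀ ∈ T' ∧ T' ⊆ T ∧ ∃ x : R3 → ℝ, ContDiff ℝ ∞ x ∧
      ∀ q ∈ T', fderiv ℝ x q (1, 0, 0) = a q ∧ fderiv ℝ x q (0, 0, 1) = b q := by
  obtain ⟨a', ha', r₁, hr₁, hB₁, heq₁⟩ := exists_contDiff_eqOn_ball hT hq₀ ha
  obtain ⟨b', hb', r₂, hr₂, hB₂, heq₂⟩ := exists_contDiff_eqOn_ball hT hq₀ hb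
  obtain ⟨C, hC, hCb⟩ := exists_contDiff_fderiv_apply_eq hb' (e := ((0, 0, 1) : R3))
    ((ContinuousLinearMap.snd ℝ ℝ ℝ).comp (ContinuousLinearMap.snd ℝ ℝ (ℝ × ℝ))) rfl
  -- the part of `a` not accounted for by `C` does not depend on `z`
  set ρ : R3 → ℝ := fun q => a' q - fderiv ℝ C q (1, 0, 0) with hρ
  have hdC : ContDiff ℝ ∞ fun q => fderiv ℝ C q (1, 0, 0) :=
    (hC.fderiv_right (m := ∞) (by simp)).clm_apply contDiff_const
  have hρs : ContDiff ℝ ∞ ρ := ha'.sub hdC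
  set B := Metric.ball q₀ (min r₁ r₂) with hBdef
  have hBo : IsOpen B := Metric.isOpen_ball
  have hs₁ : B ⊆ Metric.ball q₀ r₁ := Metric.ball_subset_ball (min_le_left _ _)
  have hs₂ : B ⊆ Metric.ball q₀ r₂ := Metric.ball_subset_ball (min_le_right _ _)
  have hρ0 : ∀ q ∈ B, fderiv ℝ ρ q (0, 0, 1) = 0 := by
    intro q hq
    have hsymm : IsSymmSndFDerivAt ℝ C q :=
      hC.contDiffAt.isSymmSndFDerivAt (n := ∞)
        (by rw [minSmoothness_of_isRCLikeNormedField]; exact WithTop.coe_le_coe.2 le_top)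
    have hdd : DifferentiableAt ℝ (fderiv ℝ C) q :=
      (hC.fderiv_right (m := ∞) (by simp)).differentiable (by simp) q
    have e1 : fderiv ℝ (fun q => fderiv ℝ C q (1, 0, 0)) q (0, 0, 1)
        = fderiv ℝ b q (1, 0, 0) := by
      have h1 : (fun q => fderiv ℝ C q (0, 0, 1)) =ᶠ[nhds q] b := by
        filter_upwards [hBo.mem_nhds hq] with y hy
        rw [hCb, heq₂ (hs₂ hy)]
      rw [← h1.fderiv_eq, fderiv_clm_apply hdd (by fun_prop), fderiv_clm_apply hdd (by fun_prop)]
      simpa using hsymm.eq _ _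
    have e2 : a' =ᶠ[nhds q] a := by
      filter_upwards [hBo.mem_nhds hq] with y hy using heq₁ (hs₁ hy)
    rw [hρ, fderiv_fun_sub (ha'.differentiable (by simp) q) (hdC.differentiable (by simp) q),
      sub_apply, e1, e2.fderiv_eq, hab q (hB₁ (hs₁ hq)), sub_self]
  have hP : ContDiff ℝ ∞ fun q : R3 => ((q.1, q.2.1, q₀.2.2) : R3) := by fun_prop
  obtain ⟨D, hD, hDρ⟩ := exists_contDiff_fderiv_apply_eq (hρs.comp hP) (e := ((1, 0, 0) : R3))
    (ContinuousLinearMap.fst ℝ ℝ (ℝ × ℝ)) rfl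
  have hDP : ContDiff ℝ ∞ fun q : R3 => D (q.1, q.2.1, q₀.2.2) := hD.comp hP
  have hDP' : ∀ q v : R3, fderiv ℝ (fun q : R3 => D (q.1, q.2.1, q₀.2.2)) q v
      = fderiv ℝ D (q.1, q.2.1, q₀.2.2) (v.1, v.2.1, 0) := by
    intro q v
    have hy : HasFDerivAt (fun q : R3 => q.2.1) _ q := ((ContinuousLinearMap.fst ℝ ℝ ℝ).comp
      (ContinuousLinearMap.snd ℝ ℝ (ℝ × ℝ))).hasFDerivAt
    have h1 : HasFDerivAt (fun q : R3 => ((q.1, q.2.1, q₀.2.2) : R3)) _ q :=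
      hasFDerivAt_fst.prodMk (hy.prodMk (hasFDerivAt_const q₀.2.2 q))
    have h2 := ((hD.differentiable (by simp) (q.1, q.2.1, q₀.2.2)).hasFDerivAt).comp q h1
    change fderiv ℝ (D ∘ fun q : R3 => ((q.1, q.2.1, q₀.2.2) : R3)) q v = _
    rw [h2.fderiv]
    simp
  refine ⟨B, hBo, Metric.mem_ball_self (by positivity), hs₁.trans hB₁,
    fun q => C q + D (q.1, q.2.1, q₀.2.2), hC.add hDP, fun q hq => ⟨?_, ?_⟩⟩
  · rw [fderiv_fun_add (hC.differentiable (by simp) q) (hDP.differentiable (by simp) q),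
      add_apply, hDP']
    have h1 := hDρ (q.1, q.2.1, q₀.2.2)
    have h2 : ρ (q.1, q.2.1, q₀.2.2) = ρ q := by
      have hq' : (q.1, q.2.1, q₀.2.2) + (q.2.2 - q₀.2.2) • ((0, 0, 1) : R3) = q := by
        simp
      have := eq_of_fderiv_apply_eq_zero (convex_ball _ _) hBo
        (hρs.differentiable (by simp)).differentiableOn hρ0 (q := (q.1, q.2.1, q₀.2.2))
        (t := q.2.2 - q₀.2.2) (e := (0, 0, 1)) ?_ (by rwa [hq'])
      · rw [hq'] at this
        exact this.symm
      · simp only [hBdef, Metric.mem_ball, Prod.dist_eq, max_lt_iff] at hq ⊢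
        exact ⟨hq.1, hq.2.1, by rw [dist_self]; positivity⟩
    simp only [Function.comp_apply] at h1
    rw [h1, h2, ← heq₁ (hs₁ hq), hρ]
    ring
  · rw [fderiv_fun_add (hC.differentiable (by simp) q) (hDP.differentiable (by simp) q),
      add_apply, hDP', hCb, heq₂ (hs₂ hq)]
    change b q + fderiv ℝ D _ (0 : R3) = _
    simp

/-! ### Smooth charts -/

/-- The inverse function theorem: a smooth map with injective derivative at `p` is a coordinate
system near `p`. -/
theorem exists_isSmoothChart {V : Set R3} (hV : IsOpen V) {p : R3} (hp : p ∈ V) {F : R3 → R3}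
    (hF : ContDiffOn ℝ ∞ F V) (hinj : ∀ v, fderiv ℝ F p v = 0 → v = 0) :
    ∃ φ : OpenPartialHomeomorph R3 R3, IsSmoothChart φ ∧ p ∈ φ.source ∧ φ.source ⊆ V ∧
      ∀ q, φ q = F q := by
  have hequiv : fderiv ℝ F p ∈ Set.range ((↑) : (R3 ≃L[ℝ] R3) → R3 →L[ℝ] R3) :=
    ⟨(LinearEquiv.ofInjectiveEndo (fderiv ℝ F p : R3 →ₗ[ℝ] R3)
      ((injective_iff_map_eq_zero _).2 hinj)).toContinuousLinearEquiv, ContinuousLinearMap.ext fun _ => rfl⟩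
  set V' := V ∩ fderiv ℝ F ⁻¹' Set.range ((↑) : (R3 ≃L[ℝ] R3) → R3 →L[ℝ] R3) with hV'
  have hV'o : IsOpen V' :=
    (hF.continuousOn_fderiv_of_isOpen hV (by simp)).isOpen_inter_preimage hV
      ContinuousLinearEquiv.isOpen
  obtain ⟨e, he⟩ := hequiv
  have hd : ∀ q ∈ V, HasFDerivAt F (fderiv ℝ F q) q := fun q hq =>
    ((hF.contDiffAt (hV.mem_nhds hq)).differentiableAt (by simp)).hasFDerivAt
  have hcd := hF.contDiffAt (hV.mem_nhds hp)
  have hd' : HasFDerivAt F (e : R3 →L[ℝ] R3) p := he ▸ hd p hp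
  set φ := (hcd.toOpenPartialHomeomorph F hd' (by simp)).restrOpen V' hV'o with hφ
  have hco : ∀ q, φ q = F q := fun q => rfl
  have hsub : φ.source ⊆ V' := fun q hq => hq.2
  refine ⟨φ, ⟨(hF.mono fun q hq => (hsub hq).1).congr fun q _ => hco q, fun y hy => ?_⟩,
    ⟨hcd.mem_toOpenPartialHomeomorph_source hd' (by simp), hp, e, he⟩, fun q hq => (hsub hq).1, hco⟩
  have hy' := hsub (φ.map_target hy)
  obtain ⟨e', he'⟩ := hy'.2
  exact (φ.contDiffAt_symm hy (f₀' := e') (by rw [he']; exact hd _ hy'.1)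
    (hF.contDiffAt (hV.mem_nhds hy'.1))).contDiffWithinAt

namespace IsSmoothChart

variable {φ : OpenPartialHomeomorph R3 R3}

theorem hasFDerivAt (hφ : IsSmoothChart φ) {q : R3} (hq : q ∈ φ.source) :
    HasFDerivAt φ (fderiv ℝ φ q) q :=
  ((hφ.1.contDiffAt (φ.open_source.mem_nhds hq)).differentiableAt (by simp)).hasFDerivAt

theorem hasFDerivAt_symm (hφ : IsSmoothChart φ) {y : R3} (hy : y ∈ φ.target) :
    HasFDerivAt φ.symm (fderiv ℝ φ.symm y) y :=
  ((hφ.2.contDiffAt (φ.open_target.mem_nhds hy)).differentiableAt (by simp)).hasFDerivAt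

theorem fderiv_symm_fderiv (hφ : IsSmoothChart φ) {q : R3} (hq : q ∈ φ.source) (v : R3) :
    fderiv ℝ φ.symm (φ q) (fderiv ℝ φ q v) = v := by
  have h1 := (hφ.hasFDerivAt_symm (φ.map_source hq)).comp q (hφ.hasFDerivAt hq)
  have h2 := h1.unique ((hasFDerivAt_id q).congr_of_eventuallyEq (φ.eventually_left_inverse hq))
  simpa using DFunLike.congr_fun h2 v

end IsSmoothChart

/-! ### Rectification of two commuting fields -/

/-- Let `X`, `Z` be commuting, independent at `p` and tangent to the level surfaces of `k`, where
`dk ≠ 0` at `p`. The one-form dual to `X` on the leaves `k = const` is closed because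
`[X, Z] = 0`, so it has a potential `x`, which depends smoothly on the leaf. -/
theorem exists_dual_coordinate {V : Set R3} (hV : IsOpen V) {p : R3} (hp : p ∈ V)
    {X Z : R3 → R3} (hX : ContDiffOn ℝ ∞ X V) (hZ : ContDiffOn ℝ ∞ Z V) {k : R3 → ℝ}
    (hk : ContDiffOn ℝ ∞ k V) (hXZ : ∀ q ∈ V, VectorField.lieBracket ℝ X Z q = 0)
    (hkX : ∀ q ∈ V, fderiv ℝ k q (X q) = 0) (hkZ : ∀ q ∈ V, fderiv ℝ k q (Z q) = 0)
    (hdk : fderiv ℝ k p ≠ 0) (hlin : ∀ a c : ℝ, a • X p + c • Z p = 0 → a = 0 ∧ c = 0) :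
    ∃ W : Set R3, IsOpen W ∧ p ∈ W ∧ W ⊆ V ∧ ∃ x : R3 → ℝ, ContDiffOn ℝ ∞ x W ∧
      ∀ q ∈ W, fderiv ℝ x q (X q) = 1 ∧ fderiv ℝ x q (Z q) = 0 := by
  obtain ⟨w, hw⟩ : ∃ w, fderiv ℝ k p w ≠ 0 := by
    by_contra! h
    exact hdk (ContinuousLinearMap.ext h)
  -- linear functionals `l₁`, `l₂` dual to `X p`, `Z p`; then `(l₁, k, l₂)` are coordinates at `p`
  let T : R3 →ₗ[ℝ] R3 :=
    (LinearMap.toSpanSingleton ℝ R3 (X p)).coprod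
      ((LinearMap.toSpanSingleton ℝ R3 w).coprod (LinearMap.toSpanSingleton ℝ R3 (Z p)))
  have hT : ∀ a b c : ℝ, T (a, b, c) = a • X p + (b • w + c • Z p) := fun _ _ _ => rfl
  have hTinj : Function.Injective T := by
    refine (injective_iff_map_eq_zero T).2 ?_
    rintro ⟨a, b, c⟩ h
    rw [hT] at h
    have h1 := congrArg (fderiv ℝ k p) h
    simp only [map_add, map_smul, hkX p hp, hkZ p hp, smul_eq_mul, mul_zero, zero_add, add_zero,
      map_zero, mul_eq_zero, hw, or_false] at h1
    subst h1
    obtain ⟨rfl, rfl⟩ := hlin a c (by simpa using h)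
    rfl
  let E := LinearEquiv.ofInjectiveEndo T hTinj
  let l₁ : R3 →L[ℝ] ℝ := LinearMap.toContinuousLinearMap ((LinearMap.fst ℝ ℝ (ℝ × ℝ)) ∘ₗ
    (E.symm : R3 →ₗ[ℝ] R3))
  let l₂ : R3 →L[ℝ] ℝ := LinearMap.toContinuousLinearMap ((LinearMap.snd ℝ ℝ ℝ) ∘ₗ
    (LinearMap.snd ℝ ℝ (ℝ × ℝ)) ∘ₗ (E.symm : R3 →ₗ[ℝ] R3))
  have hl₁ : ∀ v, l₁ v = (E.symm v).1 := fun _ => rfl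
  have hl₂ : ∀ v, l₂ v = (E.symm v).2.2 := fun _ => rfl
  have hEX : E.symm (X p) = (1, 0, 0) := by
    rw [LinearEquiv.symm_apply_eq]; change _ = T _; simp [hT]
  have hEZ : E.symm (Z p) = (0, 0, 1) := by
    rw [LinearEquiv.symm_apply_eq]; change _ = T _; simp [hT]
  set A : R3 → ℝ := fun q => l₁ (X q) with hA
  set B : R3 → ℝ := fun q => l₂ (X q) with hB
  set C : R3 → ℝ := fun q => l₁ (Z q) with hC
  set D : R3 → ℝ := fun q => l₂ (Z q) with hD
  have hAs : ContDiffOn ℝ ∞ A V := l₁.contDiff.comp_contDiffOn hX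
  have hBs : ContDiffOn ℝ ∞ B V := l₂.contDiff.comp_contDiffOn hX
  have hCs : ContDiffOn ℝ ∞ C V := l₁.contDiff.comp_contDiffOn hZ
  have hDs : ContDiffOn ℝ ∞ D V := l₂.contDiff.comp_contDiffOn hZ
  have hΔs : ContDiffOn ℝ ∞ (fun q => A q * D q - B q * C q) V := (hAs.mul hDs).sub (hBs.mul hCs)
  set V₁ := V ∩ (fun q => A q * D q - B q * C q) ⁻¹' {0}ᶜ with hV₁
  have hV₁o : IsOpen V₁ := hΔs.continuousOn.isOpen_inter_preimage hV isOpen_compl_singleton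
  have hpV₁ : p ∈ V₁ := ⟨hp, by simp [hA, hB, hC, hD, hl₁, hl₂, hEX, hEZ]⟩
  have hF : ContDiffOn ℝ ∞ (fun q : R3 => ((l₁ q, k q, l₂ q) : R3)) V₁ :=
    l₁.contDiff.contDiffOn.prodMk ((hk.mono Set.inter_subset_left).prodMk l₂.contDiff.contDiffOn)
  have hkd : ∀ q ∈ V, HasFDerivAt k (fderiv ℝ k q) q := fun q hq =>
    ((hk.contDiffAt (hV.mem_nhds hq)).differentiableAt (by simp)).hasFDerivAt
  have hF' : ∀ q ∈ V, ∀ v, fderiv ℝ (fun q : R3 => ((l₁ q, k q, l₂ q) : R3)) q v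
      = (l₁ v, fderiv ℝ k q v, l₂ v) := by
    intro q hq v
    rw [(l₁.hasFDerivAt.prodMk ((hkd q hq).prodMk l₂.hasFDerivAt)).fderiv]
    rfl
  obtain ⟨ψ, hψ, hpψ, hψV, hψF⟩ := exists_isSmoothChart hV₁o hpV₁ hF (fun v hv => by
    rw [hF' p hp] at hv
    simp only [Prod.mk_eq_zero, hl₁, hl₂] at hv
    obtain ⟨h1, h2, h3⟩ := hv
    have h4 : v = (E.symm v).2.1 • w := by
      have : v = T (E.symm v) := (E.apply_symm_apply v).symm
      rw [show E.symm v = ((E.symm v).1, (E.symm v).2.1, (E.symm v).2.2) from rfl, hT, h1, h3]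
        at this
      simpa using this
    rw [h4, map_smul, smul_eq_mul, mul_eq_zero, or_iff_left hw] at h2
    rw [h4, h2, zero_smul])
  have hψ' : ∀ q ∈ ψ.source, ∀ v, fderiv ℝ ψ q v = (l₁ v, fderiv ℝ k q v, l₂ v) := fun q hq v => by
    rw [show (ψ : R3 → R3) = _ from funext hψF, hF' q (hψV hq).1]
  have hΔ : ∀ q ∈ ψ.source, A q * D q - B q * C q ≠ 0 := fun q hq => (hψV hq).2
  -- the coordinate fields of `ψ` along the leaves, in terms of `X` and `Z`
  have hσ₁ : ∀ q ∈ ψ.source, fderiv ℝ ψ.symm (ψ q) (1, 0, 0) =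
      (D q / (A q * D q - B q * C q)) • X q - (B q / (A q * D q - B q * C q)) • Z q := by
    intro q hq
    rw [← hψ.fderiv_symm_fderiv hq ((D q / (A q * D q - B q * C q)) • X q -
      (B q / (A q * D q - B q * C q)) • Z q)]
    congr 1
    have := hΔ q hq
    simp only [hψ' q hq, map_sub, map_smul, hkX q (hψV hq).1, hkZ q (hψV hq).1, smul_eq_mul]
    change _ = ((_ * A q - _ * C q, _, _ * B q - _ * D q) : R3)
    generalize hδ : A q * D q - B q * C q = δ at this ⊢
    ext
    · change (1 : ℝ) = _
      field_simp
      linear_combination (-1 : ℝ) * hδ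
    · simp
    · change (0 : ℝ) = _
      field_simp
      ring
  have hσ₃ : ∀ q ∈ ψ.source, fderiv ℝ ψ.symm (ψ q) (0, 0, 1) =
      (A q / (A q * D q - B q * C q)) • Z q - (C q / (A q * D q - B q * C q)) • X q := by
    intro q hq
    rw [← hψ.fderiv_symm_fderiv hq ((A q / (A q * D q - B q * C q)) • Z q -
      (C q / (A q * D q - B q * C q)) • X q)]
    congr 1
    have := hΔ q hq
    simp only [hψ' q hq, map_sub, map_smul, hkX q (hψV hq).1, hkZ q (hψV hq).1, smul_eq_mul]
    change _ = ((_ * C q - _ * A q, _, _ * D q - _ * B q) : R3)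
    generalize hδ : A q * D q - B q * C q = δ at this ⊢
    ext
    · change (0 : ℝ) = _
      field_simp
      ring
    · simp
    · change (1 : ℝ) = _
      field_simp
      linear_combination (-1 : ℝ) * hδ
  have hsub : ψ.source ⊆ V := fun q hq => (hψV hq).1
  have has : ContDiffOn ℝ ∞ (fun q => D q / (A q * D q - B q * C q)) ψ.source :=
    (hDs.mono hsub).div (hΔs.mono hsub) hΔ
  have hbs : ContDiffOn ℝ ∞ (fun q => -C q / (A q * D q - B q * C q)) ψ.source :=
    (hCs.mono hsub).neg.div (hΔs.mono hsub) hΔ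
  have hcomp : ∀ c : R3 → ℝ, ContDiffOn ℝ ∞ c ψ.source → ∀ q ∈ ψ.source, ∀ v,
      fderiv ℝ (c ∘ ψ.symm) (ψ q) v = fderiv ℝ c q (fderiv ℝ ψ.symm (ψ q) v) := by
    intro c hc q hq v
    have h1 : HasFDerivAt c (fderiv ℝ c q) (ψ.symm (ψ q)) := by
      rw [ψ.left_inv hq]
      exact ((hc.contDiffAt (ψ.open_source.mem_nhds hq)).differentiableAt (by simp)).hasFDerivAt
    rw [(h1.comp (ψ q) (hψ.hasFDerivAt_symm (ψ.map_source hq))).fderiv]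
    rfl
  have hsX : ∀ q ∈ V, HasFDerivAt X (fderiv ℝ X q) q := fun q hq =>
    ((hX.contDiffAt (hV.mem_nhds hq)).differentiableAt (by simp)).hasFDerivAt
  have hsZ : ∀ q ∈ V, HasFDerivAt Z (fderiv ℝ Z q) q := fun q hq =>
    ((hZ.contDiffAt (hV.mem_nhds hq)).differentiableAt (by simp)).hasFDerivAt
  obtain ⟨T', hT'o, hpT', hT'sub, x, hx, hx'⟩ := exists_leafwise_potential ψ.open_target
    (ψ.map_source hpψ) (has.comp hψ.2 ψ.symm.mapsTo) (hbs.comp hψ.2 ψ.symm.mapsTo) (by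
      intro y hy
      obtain ⟨q, hq, rfl⟩ : ∃ q ∈ ψ.source, ψ q = y :=
        ⟨ψ.symm y, ψ.map_target hy, ψ.right_inv hy⟩
      rw [hcomp _ has q hq, hcomp _ hbs q hq, hσ₁ q hq, hσ₃ q hq]
      have hA' := l₁.hasFDerivAt.comp q (hsX q (hsub hq))
      have hB' := l₂.hasFDerivAt.comp q (hsX q (hsub hq))
      have hC' := l₁.hasFDerivAt.comp q (hsZ q (hsub hq))
      have hD' := l₂.hasFDerivAt.comp q (hsZ q (hsub hq))
      have hΔ' := ((hasDerivAt_inv (hΔ q hq)).comp_hasFDerivAt q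
        ((hA'.mul hD').sub (hB'.mul hC')))
      have hbr : fderiv ℝ Z q (X q) = fderiv ℝ X q (Z q) := by
        have := hXZ q (hsub hq)
        rwa [VectorField.lieBracket, sub_eq_zero] at this
      have e1 : fderiv ℝ (fun q => D q * (A q * D q - B q * C q)⁻¹) q = _ := (hD'.mul hΔ').fderiv
      have e2 : fderiv ℝ (fun q => -C q * (A q * D q - B q * C q)⁻¹) q = _ :=
        (hC'.neg.mul hΔ').fderiv
      have f1 : (fun q => D q / (A q * D q - B q * C q)) = _ :=
        funext fun q => div_eq_mul_inv (D q) (A q * D q - B q * C q)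
      have f2 : (fun q => -C q / (A q * D q - B q * C q)) = _ :=
        funext fun q => div_eq_mul_inv (-C q) (A q * D q - B q * C q)
      rw [f1, f2, e1, e2]
      have := hΔ q hq
      simp only [add_apply, smul_apply, sub_apply, neg_apply, ContinuousLinearMap.comp_apply,
        Pi.neg_apply, Pi.sub_apply, Pi.mul_apply, Function.comp_apply, smul_eq_mul, map_sub,
        map_smul, hbr, show l₁ (X q) = A q from rfl, show l₂ (X q) = B q from rfl,
        show l₁ (Z q) = C q from rfl, show l₂ (Z q) = D q from rfl]
      generalize hδ : A q * D q - B q * C q = δ at this ⊢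
      field_simp
      rw [← hδ]
      ring)
  refine ⟨ψ.source ∩ ψ ⁻¹' T', ψ.isOpen_inter_preimage hT'o, ⟨hpψ, hpT'⟩,
    fun q hq => hsub hq.1, x ∘ ψ, hx.comp_contDiffOn (hψ.1.mono Set.inter_subset_left), ?_⟩
  intro q hq
  have h1 := ((hx.differentiable (by simp) (ψ q)).hasFDerivAt.comp q (hψ.hasFDerivAt hq.1)).fderiv
  have h2 : ∀ s t : ℝ, ((s, 0, t) : R3) = s • (1, 0, 0) + t • (0, 0, 1) := fun s t => by simp
  have := hΔ q hq.1
  rw [h1, ContinuousLinearMap.comp_apply, ContinuousLinearMap.comp_apply, hψ' q hq.1, hψ' q hq.1,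
    hkX q (hsub hq.1), hkZ q (hsub hq.1), h2 (l₁ _) (l₂ _), h2 (l₁ (Z q)) (l₂ _)]
  simp only [map_add, map_smul, hx' _ hq.2, smul_eq_mul, Function.comp_apply, ψ.left_inv hq.1]
  change A q * _ + B q * _ = 1 ∧ C q * _ + D q * _ = 0
  generalize hδ : A q * D q - B q * C q = δ at this ⊢
  constructor
  · field_simp
    linear_combination hδ
  · field_simp
    ring

theorem IsSmoothChart.exists_target_eq_ball {φ : OpenPartialHomeomorph R3 R3}
    (hφ : IsSmoothChart φ) {p : R3} (hp : p ∈ φ.source) :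
    ∃ ψ : OpenPartialHomeomorph R3 R3, IsSmoothChart ψ ∧ p ∈ ψ.source ∧ ψ.source ⊆ φ.source ∧
      (∀ q, ψ q = φ q) ∧ ∃ r > 0, ψ.target = Metric.ball (φ p) r := by
  obtain ⟨r, hr, hsub⟩ := Metric.isOpen_iff.1 φ.open_target _ (φ.map_source hp)
  refine ⟨(φ.symm.restrOpen (Metric.ball (φ p) r) Metric.isOpen_ball).symm, ⟨?_, ?_⟩, ?_, ?_,
    fun _ => rfl, r, hr, Set.inter_eq_right.2 hsub⟩
  · exact hφ.1.mono (by simp)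
  · exact hφ.2.mono fun q hq => hq.1
  · simp [hp, hr]
  · simp

/-- Commuting independent fields `X`, `Z` that are tangent to the level surfaces of a function `k`
with `dk ≠ 0` are `∂_x`, `∂_z` in coordinates `(x, y, z)` with `y = k`, whose range is a box. -/
theorem exists_chart_of_commuting {V : Set R3} (hV : IsOpen V) {p : R3} (hp : p ∈ V)
    {X Z : R3 → R3} (hX : ContDiffOn ℝ ∞ X V) (hZ : ContDiffOn ℝ ∞ Z V) {k : R3 → ℝ}
    (hk : ContDiffOn ℝ ∞ k V) (hXZ : ∀ q ∈ V, VectorField.lieBracket ℝ X Z q = 0)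
    (hkX : ∀ q ∈ V, fderiv ℝ k q (X q) = 0) (hkZ : ∀ q ∈ V, fderiv ℝ k q (Z q) = 0)
    (hdk : fderiv ℝ k p ≠ 0) (hlin : ∀ a c : ℝ, a • X p + c • Z p = 0 → a = 0 ∧ c = 0) :
    ∃ (φ : OpenPartialHomeomorph R3 R3) (x z : R3 → ℝ), IsSmoothChart φ ∧ p ∈ φ.source ∧
      φ.source ⊆ V ∧ (∃ y₀ r, 0 < r ∧ φ.target = Metric.ball y₀ r) ∧
      ContDiffOn ℝ ∞ x φ.source ∧ ContDiffOn ℝ ∞ z φ.source ∧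
      (∀ q ∈ φ.source, ∀ v, fderiv ℝ φ q v = (fderiv ℝ x q v, fderiv ℝ k q v, fderiv ℝ z q v)) ∧
      (∀ q ∈ φ.source, fderiv ℝ x q (X q) = 1 ∧ fderiv ℝ x q (Z q) = 0) ∧
      (∀ q ∈ φ.source, fderiv ℝ z q (X q) = 0 ∧ fderiv ℝ z q (Z q) = 1) := by
  obtain ⟨W₁, hW₁, hp₁, hs₁, x, hx, hx'⟩ :=
    exists_dual_coordinate hV hp hX hZ hk hXZ hkX hkZ hdk hlin
  obtain ⟨W₂, hW₂, hp₂, hs₂, z, hz, hz'⟩ :=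
    exists_dual_coordinate hV hp hZ hX hk (fun q hq => by
      rw [VectorField.lieBracket_swap, hXZ q hq, neg_zero]) hkZ hkX hdk
      (fun a c h => (hlin c a (by rwa [add_comm])).symm)
  have hxs : ContDiffOn ℝ ∞ x (W₁ ∩ W₂) := hx.mono Set.inter_subset_left
  have hzs : ContDiffOn ℝ ∞ z (W₁ ∩ W₂) := hz.mono Set.inter_subset_right
  have hks : ContDiffOn ℝ ∞ k (W₁ ∩ W₂) := hk.mono fun q hq => hs₁ hq.1
  have hWo := hW₁.inter hW₂
  have hd : ∀ f : R3 → ℝ, ContDiffOn ℝ ∞ f (W₁ ∩ W₂) → ∀ q ∈ W₁ ∩ W₂,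
      HasFDerivAt f (fderiv ℝ f q) q := fun f hf q hq =>
    ((hf.contDiffAt (hWo.mem_nhds hq)).differentiableAt (by simp)).hasFDerivAt
  have hF' : ∀ q ∈ W₁ ∩ W₂, ∀ v, fderiv ℝ (fun q : R3 => ((x q, k q, z q) : R3)) q v
      = (fderiv ℝ x q v, fderiv ℝ k q v, fderiv ℝ z q v) := by
    intro q hq v
    rw [((hd x hxs q hq).prodMk ((hd k hks q hq).prodMk (hd z hzs q hq))).fderiv]
    rfl
  obtain ⟨w, hw⟩ : ∃ w, fderiv ℝ k p w ≠ 0 := by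
    by_contra! h
    exact hdk (ContinuousLinearMap.ext h)
  have hinj : Function.Injective (fderiv ℝ (fun q : R3 => ((x q, k q, z q) : R3)) p) := by
    have hsurj : Function.Surjective
        (fderiv ℝ (fun q : R3 => ((x q, k q, z q) : R3)) p : R3 →ₗ[ℝ] R3) := by
      rintro ⟨a, b, c⟩
      refine ⟨(a - b / fderiv ℝ k p w * fderiv ℝ x p w) • X p + (b / fderiv ℝ k p w) • w +
        (c - b / fderiv ℝ k p w * fderiv ℝ z p w) • Z p, ?_⟩
      simp only [ContinuousLinearMap.coe_coe, hF' p ⟨hp₁, hp₂⟩, map_add, map_smul, hx' p hp₁,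
        hz' p hp₂, hkX p hp, hkZ p hp]
      ext
      · simp
      · simp [hw]
      · simp
    exact LinearMap.injective_iff_surjective.2 hsurj
  obtain ⟨φ₀, hφ₀, hpφ₀, hsub₀, hφ₀F⟩ := exists_isSmoothChart hWo ⟨hp₁, hp₂⟩
    (hxs.prodMk (hks.prodMk hzs)) ((injective_iff_map_eq_zero _).1 hinj)
  obtain ⟨φ, hφ, hpφ, hsub, hφF, r, hr, ht⟩ := hφ₀.exists_target_eq_ball hpφ₀
  have hs : φ.source ⊆ W₁ ∩ W₂ := hsub.trans hsub₀
  refine ⟨φ, x, z, hφ, hpφ, fun q hq => hs₁ (hs hq).1, ⟨_, r, hr, ht⟩, hxs.mono hs, hzs.mono hs,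
    fun q hq v => ?_, fun q hq => hx' q (hs hq).1, fun q hq => (hz' q (hs hq).2).symm⟩
  rw [← hF' q (hs hq), show (φ : R3 → R3) = _ from funext fun q => (hφF q).trans (hφ₀F q)]

/-- On a box, a field without `y`-component whose components satisfy the differential equations of
a triangular field is triangular. -/
theorem isTriangularOn_ball {c : R3} {r : ℝ} (hr : 0 < r) {Y : R3 → R3}
    (hY : ContDiffOn ℝ ∞ Y (Metric.ball c r)) (hy : ∀ q ∈ Metric.ball c r, (Y q).2.1 = 0)
    (hxx : ∀ q ∈ Metric.ball c r, fderiv ℝ (fun q => (Y q).1) q (1, 0, 0) = 0)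
    (hxz : ∀ q ∈ Metric.ball c r, fderiv ℝ (fun q => (Y q).1) q (0, 0, 1) = 0)
    (hzz : ∀ q ∈ Metric.ball c r, fderiv ℝ (fun q => (Y q).2.2) q (0, 0, 1) = 0) :
    IsTriangularOn (Metric.ball c r) Y := by
  have hmem : ∀ q : R3, q ∈ Metric.ball c r ↔
      dist q.1 c.1 < r ∧ dist q.2.1 c.2.1 < r ∧ dist q.2.2 c.2.2 < r := fun q => by
    simp only [Metric.mem_ball, Prod.dist_eq, max_lt_iff]
  have hd₁ : DifferentiableOn ℝ (fun q => (Y q).1) (Metric.ball c r) :=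
    (contDiff_fst.comp_contDiffOn hY).differentiableOn (by simp)
  have hd₃ : DifferentiableOn ℝ (fun q => (Y q).2.2) (Metric.ball c r) :=
    ((contDiff_snd.comp contDiff_snd).comp_contDiffOn hY).differentiableOn (by simp)
  have hcv : Convex ℝ (Metric.ball c r) := convex_ball c r
  refine ⟨fun y => (Y (c.1, y, c.2.2)).1, fun s => (Y (s.1, s.2, c.2.2)).2.2, ?_, ?_, ?_⟩
  · refine contDiff_fst.comp_contDiffOn (hY.comp (by fun_prop) ?_)
    rintro _ ⟨q, hq, rfl⟩
    exact (hmem _).2 ⟨by simpa, ((hmem q).1 hq).2.1, by simpa⟩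
  · refine (contDiff_snd.comp contDiff_snd).comp_contDiffOn (hY.comp (by fun_prop) ?_)
    rintro _ ⟨q, hq, rfl⟩
    exact (hmem _).2 ⟨((hmem q).1 hq).1, ((hmem q).1 hq).2.1, by simpa⟩
  · intro q hq
    have h := (hmem q).1 hq
    have hq' : ((q.1, q.2.1, c.2.2) : R3) ∈ Metric.ball c r := (hmem _).2 ⟨h.1, h.2.1, by simpa⟩
    have hq'' : ((c.1, q.2.1, c.2.2) : R3) ∈ Metric.ball c r :=
      (hmem _).2 ⟨by simpa, h.2.1, by simpa⟩
    have e₁ : (q.1, q.2.1, c.2.2) + (q.2.2 - c.2.2) • ((0, 0, 1) : R3) = q := by simp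
    have e₂ : (c.1, q.2.1, c.2.2) + (q.1 - c.1) • ((1, 0, 0) : R3) = (q.1, q.2.1, c.2.2) := by
      simp
    have h₁ := eq_of_fderiv_apply_eq_zero hcv Metric.isOpen_ball hd₁ hxz hq'
      (t := q.2.2 - c.2.2) (by rwa [e₁])
    have h₂ := eq_of_fderiv_apply_eq_zero hcv Metric.isOpen_ball hd₁ hxx hq''
      (t := q.1 - c.1) (by rwa [e₂])
    have h₃ := eq_of_fderiv_apply_eq_zero hcv Metric.isOpen_ball hd₃ hzz hq'
      (t := q.2.2 - c.2.2) (by rwa [e₁])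
    rw [e₁] at h₁ h₃
    rw [e₂] at h₂
    ext
    · exact h₁.trans h₂
    · exact hy q hq
    · exact h₃

/-! ### Central fields and the normal form -/

namespace VF

variable {U : TopologicalSpace.Opens R3}

theorem mem_center_iff {g : LieSubalgebra ℝ (VF U)} {X : VF U} :
    X ∈ center g ↔ X ∈ g ∧ ∀ Y ∈ g, ⁅Y, X⁆ = 0 := by
  constructor
  · rintro ⟨X, hX, rfl⟩
    exact ⟨X.2, fun Y hY => congrArg Subtype.val (hX ⟨Y, hY⟩)⟩
  · rintro ⟨hX, h⟩
    exact ⟨⟨X, hX⟩, fun Y => Subtype.ext (h Y.1 Y.2), rfl⟩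

theorem bddAbove_rank (S : Submodule ℝ (VF U)) :
    BddAbove (Set.range fun p : U => Module.finrank ℝ (S.map (evalAt p.1))) :=
  ⟨Module.finrank ℝ R3, by rintro _ ⟨p, rfl⟩; exact Submodule.finrank_le _⟩

/-- Elements of a space of rank at most one are proportional wherever one does not vanish. -/
theorem exists_eq_smul_of_rank_le_one {S : Submodule ℝ (VF U)} (hS : rank S ≤ 1) {X Z : VF U}
    (hX : X ∈ S) (hZ : Z ∈ S) {p : R3} (hp : p ∈ U) (h0 : Z.1 p ≠ 0) :
    ∃ c : ℝ, X.1 p = c • Z.1 p := by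
  have h1 : Module.finrank ℝ (S.map (evalAt p)) ≤ 1 :=
    (le_ciSup (bddAbove_rank S) (⟨p, hp⟩ : U)).trans hS
  have hZ' : Z.1 p ∈ S.map (evalAt p) := ⟨Z, hZ, rfl⟩
  have hX' : X.1 p ∈ S.map (evalAt p) := ⟨X, hX, rfl⟩
  generalize S.map (evalAt p) = T at h1 hZ' hX'
  obtain ⟨v, hv⟩ := finrank_le_one_iff.1 h1
  obtain ⟨a, ha⟩ := hv ⟨Z.1 p, hZ'⟩
  obtain ⟨b, hb⟩ := hv ⟨X.1 p, hX'⟩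
  have ha' : a • (v : R3) = Z.1 p := congrArg Subtype.val ha
  have hb' : b • (v : R3) = X.1 p := congrArg Subtype.val hb
  have ha0 : a ≠ 0 := by
    rintro rfl
    exact h0 (by rw [← ha', zero_smul])
  exact ⟨b / a, by rw [← ha', ← hb', smul_smul, div_mul_cancel₀ _ ha0]⟩

/-- If `X = k Z` near `q` and `[Y, Z] = 0`, then `[Y, X] = Y(k) Z` at `q`. -/
theorem bracket_apply_of_eq_smul {V : Set R3} (hV : IsOpen V) {X Y Z : VF U} {k : R3 → ℝ}
    (hXk : ∀ q ∈ V, X.1 q = k q • Z.1 q) (hYZ : ⁅Y, Z⁆ = 0) {q : R3} (hq : q ∈ V) (hqU : q ∈ U)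
    (hk : DifferentiableAt ℝ k q) :
    (⁅Y, X⁆ : VF U).1 q = fderiv ℝ k q (Y.1 q) • Z.1 q := by
  have h1 : X.1 =ᶠ[nhds q] fun y => k y • Z.1 y := by
    filter_upwards [hV.mem_nhds hq] with y hy using hXk y hy
  have h2 : VectorField.lieBracket ℝ Y.1 Z.1 q = 0 := by
    rw [← bracket_apply Y Z hqU, hYZ]; rfl
  rw [bracket_apply _ _ hqU,
    Filter.EventuallyEq.lieBracket_vectorField_eq (Filter.EventuallyEq.refl _ Y.1) h1,
    VectorField.lieBracket_smul_right hk (Z.differentiableAt hqU), h2, smul_zero, add_zero]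

theorem fderiv_eq_zero_of_eq_smul {V : Set R3} (hV : IsOpen V) {X Y Z : VF U} {k : R3 → ℝ}
    (hXk : ∀ q ∈ V, X.1 q = k q • Z.1 q) (hYZ : ⁅Y, Z⁆ = 0) (hYX : ⁅Y, X⁆ = 0) {q : R3}
    (hq : q ∈ V) (hqU : q ∈ U) (hk : DifferentiableAt ℝ k q) (h0 : Z.1 q ≠ 0) :
    fderiv ℝ k q (Y.1 q) = 0 := by
  have := bracket_apply_of_eq_smul hV hXk hYZ hq hqU hk
  rw [hYX] at this
  exact (smul_eq_zero.1 this.symm).resolve_right h0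

theorem contDiffOn_quotient {V : Set R3} (hVU : V ⊆ U) {X Z : VF U} (l : R3 →L[ℝ] ℝ)
    (hl : ∀ q ∈ V, l (Z.1 q) ≠ 0) : ContDiffOn ℝ ∞ (fun q => l (X.1 q) / l (Z.1 q)) V :=
  (l.contDiff.comp_contDiffOn (X.2.1.mono hVU)).div (l.contDiff.comp_contDiffOn (Z.2.1.mono hVU)) hl

theorem eq_smul_of_exists {X Z : VF U} (l : R3 →L[ℝ] ℝ) {q : R3} (hl : l (Z.1 q) ≠ 0)
    (h : ∃ c : ℝ, X.1 q = c • Z.1 q) : X.1 q = (l (X.1 q) / l (Z.1 q)) • Z.1 q := by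
  obtain ⟨c, hc⟩ := h
  rw [hc, map_smul, smul_eq_mul, mul_div_cancel_right₀ _ hl]

/-- In a nilpotent Lie algebra, a subspace that is not everything misses an element whose
brackets all lie in it: look at the last term of the lower central series that is not contained in
the subspace. -/
theorem exists_notMem_forall_bracket_mem {g : LieSubalgebra ℝ (VF U)} (hnil : LieRing.IsNilpotent g)
    {I : Set (VF U)} (h0 : (0 : VF U) ∈ I) (hI : ∃ X ∈ g, X ∉ I) :
    ∃ X ∈ g, X ∉ I ∧ ∀ Y ∈ g, ⁅Y, X⁆ ∈ I := by
  obtain ⟨k, hk⟩ := (LieModule.isNilpotent_iff ℝ g g).1 hnil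
  have hex : ∃ k, ∀ X ∈ LieModule.lowerCentralSeries ℝ g g k, (X : VF U) ∈ I := by
    refine ⟨k, fun X hX => ?_⟩
    rw [hk, LieSubmodule.mem_bot] at hX
    rwa [hX]
  classical
  obtain ⟨n, hn⟩ : ∃ n, Nat.find hex = n + 1 := by
    refine Nat.exists_eq_succ_of_ne_zero fun h => ?_
    have := Nat.find_spec hex
    rw [h] at this
    obtain ⟨X, hX, hXI⟩ := hI
    exact hXI (this ⟨X, hX⟩ (by simp))
  have h1 := Nat.find_min hex (m := n) (by omega)
  push Not at h1
  obtain ⟨X, hX, hXI⟩ := h1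
  refine ⟨X, X.2, hXI, fun Y hY => ?_⟩
  have h2 := Nat.find_spec hex
  rw [hn] at h2
  refine h2 ⁅(⟨Y, hY⟩ : g), X⁆ ?_
  rw [LieModule.lowerCentralSeries_succ]
  exact LieSubmodule.lie_mem_lie (LieSubmodule.mem_top _) hX


/-- The normal form: coordinates around some point of `W` in which the elements of `g` are
triangular. -/
theorem exists_triangular_chart (g : LieSubalgebra ℝ (VF U)) (hnil : LieRing.IsNilpotent g)
    (hab : ¬ IsLieAbelian g) (hloc : LocallyFaithful g) (hrank : rank (center g) = 1)
    (hdim : 2 ≤ Module.finrank ℝ (center g)) {W : Set R3} (hW : IsOpen W) (hWne : W.Nonempty)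
    (hWU : W ⊆ U) :
    ∃ φ : OpenPartialHomeomorph R3 R3, IsSmoothChart φ ∧ φ.source.Nonempty ∧ φ.source ⊆ W ∧
      (∀ X ∈ g, ∃ Y : R3 → R3, IsTriangularOn φ.target Y ∧ HasExpression φ X Y) ∧
      (∃ X ∈ g, HasExpression φ X (fun _ => (1, 0, 0))) ∧
      (∃ X ∈ center g, HasExpression φ X (fun _ => (0, 0, 1))) := by
  -- central fields `Z` and `Z₁ = k Z` with `k` not locally constant
  obtain ⟨Z, hZ, hZ0⟩ : ∃ Z ∈ center g, Z ≠ 0 := by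
    by_contra! h
    have := finrank_le_one (R := ℝ) (0 : center g) fun w => ⟨0, by
      rw [zero_smul]; exact Subtype.ext (h w.1 w.2).symm⟩
    omega
  obtain ⟨Z₁, hZ₁, hind⟩ : ∃ Z₁ ∈ center g, ∀ c : ℝ, Z₁ ≠ c • Z := by
    by_contra! h
    have := finrank_le_one (R := ℝ) (⟨Z, hZ⟩ : center g) fun w => by
      obtain ⟨c, hc⟩ := h w.1 w.2
      exact ⟨c, Subtype.ext hc.symm⟩
    omega
  have hZc := mem_center_iff.1 hZ
  have hZ₁c := mem_center_iff.1 hZ₁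
  obtain ⟨p₀, hp₀W, hp₀⟩ : ∃ p ∈ W, Z.1 p ≠ 0 := by
    by_contra! h
    exact hZ0 (hloc Z hZc.1 W hW hWne hWU h)
  obtain ⟨l, hl⟩ := SeparatingDual.exists_ne_zero (R := ℝ) hp₀
  obtain ⟨r, hr, hball⟩ := Metric.isOpen_iff.1
    ((l.continuous.comp_continuousOn (Z.2.1.continuousOn.mono hWU)).isOpen_inter_preimage hW
      isOpen_compl_singleton) p₀ ⟨hp₀W, hl⟩
  set B := Metric.ball p₀ r with hB
  have hBo : IsOpen B := Metric.isOpen_ball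
  have hBW : B ⊆ W := fun q hq => (hball hq).1
  have hBU : B ⊆ U := hBW.trans hWU
  have hlB : ∀ q ∈ B, l (Z.1 q) ≠ 0 := fun q hq => (hball hq).2
  have hZB : ∀ q ∈ B, Z.1 q ≠ 0 := fun q hq h => hlB q hq (by rw [h, map_zero])
  set k : R3 → ℝ := fun q => l (Z₁.1 q) / l (Z.1 q) with hk
  have hks : ContDiffOn ℝ ∞ k B := contDiffOn_quotient hBU l hlB
  have hkd : ∀ q ∈ B, DifferentiableAt ℝ k q := fun q hq =>
    (hks.contDiffAt (hBo.mem_nhds hq)).differentiableAt (by simp)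
  have hZ₁k : ∀ q ∈ B, Z₁.1 q = k q • Z.1 q := fun q hq => eq_smul_of_exists l (hlB q hq)
    (exists_eq_smul_of_rank_le_one hrank.le hZ₁ hZ (hBU hq) (hZB q hq))
  have hXk : ∀ X ∈ g, ∀ q ∈ B, fderiv ℝ k q (X.1 q) = 0 := fun X hX q hq =>
    fderiv_eq_zero_of_eq_smul hBo hZ₁k (hZc.2 X hX) (hZ₁c.2 X hX) hq (hBU hq) (hkd q hq) (hZB q hq)
  obtain ⟨p₁, hp₁B, hp₁⟩ : ∃ p ∈ B, fderiv ℝ k p ≠ 0 := by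
    by_contra! h
    obtain ⟨c, hc⟩ := hBo.exists_is_const_of_fderiv_eq_zero (𝕜 := ℝ)
      (convex_ball p₀ r).isPreconnected (fun q hq => (hkd q hq).differentiableWithinAt) h
    refine hind c (sub_eq_zero.1 (hloc (Z₁ - c • Z)
      (g.sub_mem hZ₁c.1 (g.smul_mem c hZc.1)) B hBo ⟨p₀, Metric.mem_ball_self hr⟩ hBU ?_))
    intro q hq
    change Z₁.1 q - c • Z.1 q = 0
    rw [hZ₁k q hq, hc q hq, sub_self]
  set V := B ∩ fderiv ℝ k ⁻¹' {0}ᶜ with hV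
  have hVo : IsOpen V := (hks.continuousOn_fderiv_of_isOpen hBo (by simp)).isOpen_inter_preimage hBo
    isOpen_compl_singleton
  have hVB : V ⊆ B := Set.inter_subset_left
  have hVU : V ⊆ U := hVB.trans hBU
  -- the fields proportional to `Z` on `V` do not exhaust `g`, since they commute
  set I : Set (VF U) := {X | ∀ q ∈ V, ∃ c : ℝ, X.1 q = c • Z.1 q} with hI
  have hIg : ∃ X ∈ g, X ∉ I := by
    by_contra! h
    refine hab ⟨fun X Y => Subtype.ext ?_⟩
    have hYk : ∀ q ∈ V, Y.1.1 q = (l (Y.1.1 q) / l (Z.1 q)) • Z.1 q := fun q hq =>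
      eq_smul_of_exists l (hlB q (hVB hq)) (h Y.1 Y.2 q hq)
    refine hloc ⁅X.1, Y.1⁆ (g.lie_mem X.2 Y.2) V hVo ⟨p₁, hp₁B, hp₁⟩ hVU fun q hq => ?_
    have hd : DifferentiableAt ℝ (fun q => l (Y.1.1 q) / l (Z.1 q)) q :=
      ((contDiffOn_quotient hVU l fun q hq => hlB q (hVB hq)).contDiffAt
        (hVo.mem_nhds hq)).differentiableAt (by simp)
    have hYZ : ⁅Z, Y.1⁆ = 0 := by rw [← lie_skew, hZc.2 Y.1 Y.2, neg_zero]
    obtain ⟨c, hc⟩ := h X.1 X.2 q hq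
    rw [bracket_apply_of_eq_smul hVo hYk (hZc.2 X.1 X.2) hq (hVU hq) hd, hc, map_smul,
      fderiv_eq_zero_of_eq_smul hVo hYk (lie_self Z) hYZ hq (hVU hq) hd (hZB q (hVB hq)),
      smul_zero, zero_smul]
  obtain ⟨X₀, hX₀, hX₀I, hX₀c⟩ := exists_notMem_forall_bracket_mem hnil
    (I := I) (fun q _ => ⟨0, by rw [zero_smul]; rfl⟩) hIg
  obtain ⟨p, hpV, hp⟩ : ∃ p ∈ V, ∀ c : ℝ, X₀.1 p ≠ c • Z.1 p := by
    by_contra! h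
    exact hX₀I h
  have hX₀Z : ⁅X₀, Z⁆ = 0 := hZc.2 X₀ hX₀
  obtain ⟨φ, x, z, hφ, hpφ, hφV, ⟨y₀, s, hs, ht⟩, hx, hz, hφ', hx', hz'⟩ :=
    exists_chart_of_commuting hVo hpV (X₀.2.1.mono hVU) (Z.2.1.mono hVU) (hks.mono hVB)
      (fun q hq => by rw [← bracket_apply X₀ Z (hVU hq), hX₀Z]; rfl)
      (fun q hq => hXk X₀ hX₀ q (hVB hq)) (fun q hq => hXk Z hZc.1 q (hVB hq)) hpV.2 (by
        intro a c h
        have ha : a = 0 := by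
          by_contra ha
          refine hp (-(c / a)) ?_
          have : a⁻¹ • (a • X₀.1 p + c • Z.1 p) = 0 := by rw [h, smul_zero]
          rw [smul_add, smul_smul, smul_smul, inv_mul_cancel₀ ha, one_smul] at this
          rw [eq_neg_of_add_eq_zero_left this, neg_smul, div_eq_inv_mul]
        subst ha
        rw [zero_smul, zero_add] at h
        exact ⟨rfl, (smul_eq_zero.1 h).resolve_right (hZB p (hVB hpV))⟩)
  have hφU : φ.source ⊆ U := hφV.trans hVU
  have hφX₀ : ∀ q ∈ φ.source, fderiv ℝ φ q (X₀.1 q) = (1, 0, 0) := fun q hq => by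
    rw [hφ' q hq, (hx' q hq).1, (hz' q hq).1, hXk X₀ hX₀ q (hVB (hφV hq))]
  have hφZ : ∀ q ∈ φ.source, fderiv ℝ φ q (Z.1 q) = (0, 0, 1) := fun q hq => by
    rw [hφ' q hq, (hx' q hq).2, (hz' q hq).2, hXk Z hZc.1 q (hVB (hφV hq))]
  refine ⟨φ, hφ, ⟨p, hpφ⟩, fun q hq => hBW (hVB (hφV hq)), fun X hX => ?_, ⟨X₀, hX₀, hφX₀⟩,
    ⟨Z, hZ, hφZ⟩⟩
  -- `A(u(X)) = u([A, X])` if `u` is a coordinate function and `u(A)` is constant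
  have hlie : ∀ (u : R3 → ℝ), ContDiffOn ℝ ∞ u φ.source → ∀ (A : VF U) (c : ℝ),
      (∀ q ∈ φ.source, fderiv ℝ u q (A.1 q) = c) → ∀ q ∈ φ.source,
      fderiv ℝ (fun q => fderiv ℝ u q (X.1 q)) q (A.1 q) = fderiv ℝ u q ((⁅A, X⁆ : VF U).1 q) := by
    intro u hu A c hc q hq
    have hn := φ.open_source.mem_nhds hq
    rw [bracket_apply _ _ (hφU hq), VectorField.fderiv_apply_lieBracket (n := ∞) (hu.contDiffAt hn)
      (by rw [minSmoothness_of_isRCLikeNormedField]; exact WithTop.coe_le_coe.2 le_top)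
      (X.differentiableAt (hφU hq)) (A.differentiableAt (hφU hq))]
    have h1 : (fun q => fderiv ℝ u q (A.1 q)) =ᶠ[nhds q] fun _ => c := by
      filter_upwards [hn] with y hy using hc y hy
    rw [h1.fderiv_eq]
    simp
  have hus : ∀ (u : R3 → ℝ), ContDiffOn ℝ ∞ u φ.source →
      ContDiffOn ℝ ∞ (fun q => fderiv ℝ u q (X.1 q)) φ.source := fun u hu =>
    (hu.fderiv_of_isOpen φ.open_source (m := ∞) (by simp)).clm_apply (X.2.1.mono hφU)
  have hZX : ⁅Z, X⁆ = 0 := by rw [← lie_skew, hZc.2 X hX, neg_zero]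
  have hxX₀ : ∀ q ∈ φ.source, fderiv ℝ (fun q => fderiv ℝ x q (X.1 q)) q (X₀.1 q) = 0 := by
    intro q hq
    obtain ⟨c, hc⟩ := hX₀c X hX q (hφV hq)
    have hc' : (⁅X₀, X⁆ : VF U).1 q = (-c) • Z.1 q := by
      rw [← lie_skew, neg_smul, ← hc]; rfl
    rw [hlie x hx X₀ 1 (fun q hq => (hx' q hq).1) q hq, hc', map_smul, (hx' q hq).2, smul_zero]
  have hxZ : ∀ q ∈ φ.source, fderiv ℝ (fun q => fderiv ℝ x q (X.1 q)) q (Z.1 q) = 0 := by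
    intro q hq
    rw [hlie x hx Z 0 (fun q hq => (hx' q hq).2) q hq, hZX]
    exact map_zero _
  have hzZ : ∀ q ∈ φ.source, fderiv ℝ (fun q => fderiv ℝ z q (X.1 q)) q (Z.1 q) = 0 := by
    intro q hq
    rw [hlie z hz Z 1 (fun q hq => (hz' q hq).2) q hq, hZX]
    exact map_zero _
  have hcomp : ∀ u : R3 → ℝ, ContDiffOn ℝ ∞ u φ.source → ∀ y ∈ φ.target, ∀ v,
      fderiv ℝ (fun y => fderiv ℝ u (φ.symm y) (X.1 (φ.symm y))) y (fderiv ℝ φ (φ.symm y) v) =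
        fderiv ℝ (fun q => fderiv ℝ u q (X.1 q)) (φ.symm y) v := by
    intro u hu y hy v
    have hy' := φ.map_target hy
    have h1 : HasFDerivAt (fun y => fderiv ℝ u (φ.symm y) (X.1 (φ.symm y))) _ y :=
      (((hus u hu).contDiffAt (φ.open_source.mem_nhds hy')).differentiableAt
        (by simp)).hasFDerivAt.comp y (hφ.hasFDerivAt_symm hy)
    have h2 := hφ.fderiv_symm_fderiv hy' v
    rw [φ.right_inv hy] at h2
    rw [h1.fderiv, ContinuousLinearMap.comp_apply, h2]
  refine ⟨fun y => (fderiv ℝ x (φ.symm y) (X.1 (φ.symm y)), 0,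
    fderiv ℝ z (φ.symm y) (X.1 (φ.symm y))), ?_, fun q hq => ?_⟩
  · have hsm := fun u hu => (hus u hu).comp hφ.2 φ.symm.mapsTo
    have hy' : ∀ y ∈ Metric.ball y₀ s, y ∈ φ.target := fun y hy => by rwa [ht]
    rw [ht]
    refine isTriangularOn_ball hs ?_ (fun _ _ => rfl) (fun y hy => ?_) (fun y hy => ?_)
      (fun y hy => ?_)
    · rw [← ht]
      exact (hsm x hx).prodMk (contDiffOn_const.prodMk (hsm z hz))
    · have hm := φ.map_target (hy' y hy)
      rw [← hφX₀ _ hm, hcomp x hx y (hy' y hy), hxX₀ _ hm]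
    · have hm := φ.map_target (hy' y hy)
      rw [← hφZ _ hm, hcomp x hx y (hy' y hy), hxZ _ hm]
    · have hm := φ.map_target (hy' y hy)
      rw [← hφZ _ hm, hcomp z hz y (hy' y hy), hzZ _ hm]
  · simp only [hφ' q hq, φ.left_inv hq, hXk X hX q (hVB (hφV hq))]

end VF

/-! ### Polynomials in `x` with coefficients depending on `y` -/

/-- The polynomial in `x` obtained from `P` by fixing `y`. -/
noncomputable def polySlice (P : Polynomial (ℝ → ℝ)) (y : ℝ) : Polynomial ℝ :=
  P.map (Pi.evalRingHom (fun _ => ℝ) y)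

theorem polyEval_eq_eval_polySlice (P : Polynomial (ℝ → ℝ)) (x y : ℝ) :
    polyEval P x y = (polySlice P y).eval x := by
  rw [polySlice, Polynomial.eval_map, Polynomial.eval₂_eq_sum]
  rfl

theorem coeff_polySlice (P : Polynomial (ℝ → ℝ)) (y : ℝ) (k : ℕ) :
    (polySlice P y).coeff k = P.coeff k y := by
  simp [polySlice]

theorem posDegree_iff {J : Set ℝ} {P : Polynomial (ℝ → ℝ)} :
    PosDegree J P ↔ ∃ y ∈ J, (polySlice P y).derivative ≠ 0 := by
  constructor
  · rintro ⟨k, hk, y, hy, h⟩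
    refine ⟨y, hy, fun h0 => ?_⟩
    have := congrArg (Polynomial.coeff · (k - 1)) h0
    simp only [Polynomial.coeff_derivative, coeff_polySlice, Nat.sub_add_cancel hk,
      Polynomial.coeff_zero, mul_eq_zero, h, false_or] at this
    have h2 : (0 : ℝ) ≤ (k - 1 : ℕ) := Nat.cast_nonneg _
    linarith
  · rintro ⟨y, hy, h⟩
    by_contra hn
    refine h (Polynomial.ext fun k => ?_)
    have : P.coeff (k + 1) y = 0 := by
      by_contra h'
      exact hn ⟨k + 1, by omega, y, hy, h'⟩
    simp [Polynomial.coeff_derivative, coeff_polySlice, this]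

theorem polySlice_iterate_derivative {P : Polynomial (ℝ → ℝ)} {k : ℕ} {y : ℝ}
    (h : ∀ l, k < l → P.coeff l y = 0) :
    polySlice (Polynomial.derivative^[k] P) y = Polynomial.C (k.factorial * P.coeff k y) := by
  ext m
  rw [coeff_polySlice, Polynomial.coeff_iterate_derivative, Polynomial.coeff_C]
  rcases m with - | m
  · simp [Nat.descFactorial_self]
  · simp [h (m + 1 + k) (by omega)]

/-- A polynomial that is not constant in `x` over `J` has a leading coefficient over `J`. -/
theorem PosDegree.exists_leading {J : Set ℝ} {P : Polynomial (ℝ → ℝ)} (hP : PosDegree J P) :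
    ∃ k, 1 ≤ k ∧ (∃ y ∈ J, P.coeff k y ≠ 0) ∧ ∀ l, k < l → ∀ y ∈ J, P.coeff l y = 0 := by
  classical
  obtain ⟨k₀, hk₀, hy₀⟩ := hP
  have hmem : ∀ k, (∃ y ∈ J, P.coeff k y ≠ 0) →
      k ∈ P.support.filter fun k => ∃ y ∈ J, P.coeff k y ≠ 0 := by
    intro k hk
    refine Finset.mem_filter.2 ⟨Polynomial.mem_support_iff.2 fun h => ?_, hk⟩
    obtain ⟨y, -, hy⟩ := hk
    exact hy (by rw [h]; rfl)
  obtain ⟨k, hk, hmax⟩ := Finset.exists_max_image _ id ⟨k₀, hmem k₀ hy₀⟩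
  refine ⟨k, hk₀.trans (hmax k₀ (hmem k₀ hy₀)), (Finset.mem_filter.1 hk).2, fun l hl y hy => ?_⟩
  by_contra h
  exact absurd (hmax l (hmem l ⟨y, hy, h⟩)) (not_le.2 hl)

/-- The submodule of polynomials whose coefficient at `x ^ i` lies in `S i`. -/
def coeffSubmodule (S : ℕ → Submodule ℝ (ℝ → ℝ)) : Submodule ℝ (Polynomial (ℝ → ℝ)) where
  carrier := {P | ∀ i, P.coeff i ∈ S i}
  add_mem' := fun hP hQ i => by
    rw [Polynomial.coeff_add]; exact (S i).add_mem (hP i) (hQ i)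
  zero_mem' := fun i => by rw [Polynomial.coeff_zero]; exact (S i).zero_mem
  smul_mem' := fun c P hP i => by
    rw [Polynomial.coeff_smul]; exact (S i).smul_mem c (hP i)

theorem C_mul_derivative_mem_coeffSubmodule {S : ℕ → Submodule ℝ (ℝ → ℝ)} {F : ℝ → ℝ}
    (hS : ∀ i, ∀ c ∈ S (i + 1), F * c ∈ S i) {P : Polynomial (ℝ → ℝ)} (hP : P ∈ coeffSubmodule S) :
    Polynomial.C F * P.derivative ∈ coeffSubmodule S := by
  intro i
  rw [Polynomial.coeff_C_mul, Polynomial.coeff_derivative]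
  have := (S i).smul_mem ((i : ℝ) + 1) (hS i _ (hP (i + 1)))
  convert this using 1
  ext y
  simp
  ring

/-! ### Fields polynomial in `x` -/

namespace VF

variable {U : TopologicalSpace.Opens R3}

/-- `X` is the field `F(y) ∂_x + P(x, y) ∂_z` on `U`. -/
def IsPoly (F : ℝ → ℝ) (P : Polynomial (ℝ → ℝ)) (X : VF U) : Prop :=
  ∀ p ∈ U, X.1 p = (F p.2.1, 0, polyEval P p.1 p.2.1)

namespace IsPoly

variable {F G : ℝ → ℝ} {P Q : Polynomial (ℝ → ℝ)} {X Y : VF U}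

theorem add (hX : IsPoly F P X) (hY : IsPoly G Q Y) : IsPoly (F + G) (P + Q) (X + Y) := by
  intro p hp
  change X.1 p + Y.1 p = _
  rw [hX p hp, hY p hp]
  simp [polyEval_eq_eval_polySlice, polySlice]

theorem smul (c : ℝ) (hX : IsPoly F P X) : IsPoly (c • F) (c • P) (c • X) := by
  intro p hp
  change c • X.1 p = _
  have : polySlice (c • P) p.2.1 = c • polySlice P p.2.1 := by
    ext i; simp [coeff_polySlice]
  rw [hX p hp]
  simp [polyEval_eq_eval_polySlice, this]

theorem zero : IsPoly 0 0 (0 : VF U) := fun p _ => by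
  simp [polyEval_eq_eval_polySlice, polySlice]
  rfl

/-- Only the `x`-dependence of a field `F(y) ∂_x + P(x, y) ∂_z` enters its derivative in
directions without `y`-component. -/
theorem fderiv_apply (hY : IsPoly G Q Y) {p : R3} (hp : p ∈ U) (a c : ℝ) :
    fderiv ℝ Y.1 p (a, 0, c) = (0, 0, a * (polySlice Q p.2.1).derivative.eval p.1) := by
  have h1 := ((Y.differentiableAt hp).hasFDerivAt).comp_hasDerivAt_of_eq (0 : ℝ)
    (((hasDerivAt_id (0 : ℝ)).smul_const ((a, 0, c) : R3)).const_add p) (by simp)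
  rw [one_smul] at h1
  have h2 : HasDerivAt (fun t : ℝ => ((G p.2.1, 0, (polySlice Q p.2.1).eval (p.1 + t * a)) : R3))
      (0, 0, a * (polySlice Q p.2.1).derivative.eval p.1) 0 := by
    refine (hasDerivAt_const _ _).prodMk ((hasDerivAt_const _ _).prodMk ?_)
    have := ((polySlice Q p.2.1).hasDerivAt p.1).comp_of_eq (0 : ℝ)
      (((hasDerivAt_id (0 : ℝ)).mul_const a).const_add p.1) (by simp)
    simpa [Function.comp_def, mul_comm] using this
  refine h1.unique (h2.congr_of_eventuallyEq ?_)
  have hcont : Continuous fun t : ℝ => p + t • ((a, 0, c) : R3) := by fun_prop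
  filter_upwards [hcont.continuousAt.preimage_mem_nhds
    (U.isOpen.mem_nhds (show p + (0 : ℝ) • ((a, 0, c) : R3) ∈ U by simpa))] with t ht
  have := hY _ ht
  simp only [Function.comp_apply, id_eq, this, polyEval_eq_eval_polySlice]
  simp

theorem bracket_apply (hX : IsPoly F P X) (hY : IsPoly G Q Y) {p : R3} (hp : p ∈ U) :
    (⁅X, Y⁆ : VF U).1 p = (0, 0, F p.2.1 * (polySlice Q p.2.1).derivative.eval p.1 -
      G p.2.1 * (polySlice P p.2.1).derivative.eval p.1) := by
  rw [VF.bracket_apply _ _ hp, VectorField.lieBracket, hX p hp, hY p hp, hY.fderiv_apply hp,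
    hX.fderiv_apply hp]
  simp

theorem bracket (hX : IsPoly F P X) (hY : IsPoly G Q Y) :
    IsPoly 0 (Polynomial.C F * Q.derivative - Polynomial.C G * P.derivative) ⁅X, Y⁆ := by
  intro p hp
  rw [bracket_apply hX hY hp]
  simp [polyEval_eq_eval_polySlice, polySlice, Polynomial.derivative_map]

end IsPoly

theorem isPoly_dx : IsPoly 1 0 (dx U) := fun p hp => by
  rw [dx, ofFun_apply _ _ hp]
  simp [polyEval_eq_eval_polySlice, polySlice]

theorem isPoly_dz : IsPoly 0 1 (dz U) := fun p hp => by
  rw [dz, ofFun_apply _ _ hp]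
  simp [polyEval_eq_eval_polySlice, polySlice]

theorem isPoly_lift {f : ℝ → ℝ} {P : Polynomial (ℝ → ℝ)}
    (hf : ContDiffOn ℝ ∞ f (yRange (U : Set R3))) (hP : SmoothCoeffs (yRange (U : Set R3)) P) :
    IsPoly f P (lift hf hP) := fun _ hp => ofFun_apply _ _ hp

theorem isPoly_vertical {P : Polynomial (ℝ → ℝ)} (hP : SmoothCoeffs (yRange (U : Set R3)) P) :
    IsPoly 0 P (vertical hP) := isPoly_lift _ hP

/-- The Lie algebra of the fields `F(y) ∂_x + P(x, y) ∂_z` with `F ∈ A` and with the coefficient of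
`P` at `x ^ i` in `S i`. -/
def polySubalgebra (U : TopologicalSpace.Opens R3) (A : Submodule ℝ (ℝ → ℝ))
    (S : ℕ → Submodule ℝ (ℝ → ℝ)) (hS : ∀ i, ∀ F ∈ A, ∀ c ∈ S (i + 1), F * c ∈ S i) :
    LieSubalgebra ℝ (VF U) where
  carrier := {X | ∃ F ∈ A, ∃ P ∈ coeffSubmodule S, IsPoly F P X}
  add_mem' := by
    rintro X Y ⟨F, hF, P, hP, hX⟩ ⟨G, hG, Q, hQ, hY⟩
    exact ⟨_, A.add_mem hF hG, _, (coeffSubmodule S).add_mem hP hQ, hX.add hY⟩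
  zero_mem' := ⟨0, A.zero_mem, 0, (coeffSubmodule S).zero_mem, IsPoly.zero⟩
  smul_mem' := by
    rintro c X ⟨F, hF, P, hP, hX⟩
    exact ⟨_, A.smul_mem c hF, _, (coeffSubmodule S).smul_mem c hP, hX.smul c⟩
  lie_mem' := by
    rintro X Y ⟨F, hF, P, hP, hX⟩ ⟨G, hG, Q, hQ, hY⟩
    exact ⟨0, A.zero_mem, _, (coeffSubmodule S).sub_mem
      (C_mul_derivative_mem_coeffSubmodule (fun i => hS i F hF) hQ)
      (C_mul_derivative_mem_coeffSubmodule (fun i => hS i G hG) hP), hX.bracket hY⟩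

/-- Finitely many coefficients, each in a finite-dimensional space, leave finitely many parameters. -/
theorem finiteDimensional_polySubalgebra {A : Submodule ℝ (ℝ → ℝ)}
    {S : ℕ → Submodule ℝ (ℝ → ℝ)} (hS : ∀ i, ∀ F ∈ A, ∀ c ∈ S (i + 1), F * c ∈ S i)
    [FiniteDimensional ℝ A] [∀ i, FiniteDimensional ℝ (S i)] {N : ℕ}
    (hN : ∀ i, N ≤ i → S i = ⊥) : FiniteDimensional ℝ (polySubalgebra U A S hS) := by
  let Λ : (A × ∀ i : Fin N, S i) →ₗ[ℝ] (U → R3) :=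
    { toFun := fun w p => (w.1.1 p.1.2.1, 0, ∑ i, (w.2 i).1 p.1.2.1 * p.1.1 ^ (i : ℕ))
      map_add' := fun w w' => by
        funext p
        simp [add_mul, Finset.sum_add_distrib]
      map_smul' := fun c w => by
        funext p
        simp [Finset.mul_sum, mul_assoc] }
  let ρ : polySubalgebra U A S hS →ₗ[ℝ] (U → R3) :=
    { toFun := fun X p => X.1.1 p.1
      map_add' := fun _ _ => rfl
      map_smul' := fun _ _ => rfl }
  have hρ : ∀ X, ρ X ∈ LinearMap.range Λ := by
    rintro ⟨X, F, hF, P, hP, hX⟩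
    refine ⟨(⟨F, hF⟩, fun i => ⟨P.coeff i, hP i⟩), ?_⟩
    funext p
    have hdeg : (polySlice P p.1.2.1).natDegree < N + 1 := by
      refine Nat.lt_succ_of_le (Polynomial.natDegree_le_iff_coeff_eq_zero.2 fun i hi => ?_)
      have := hP i
      rw [hN i hi.le, Submodule.mem_bot] at this
      rw [coeff_polySlice, this]; rfl
    have h0 : P.coeff N = 0 := by
      have := hP N
      rwa [hN N le_rfl, Submodule.mem_bot] at this
    change _ = X.1 p.1
    rw [hX p.1 p.2, polyEval_eq_eval_polySlice, Polynomial.eval_eq_sum_range' hdeg,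
      Finset.sum_range_succ, coeff_polySlice, h0, Finset.sum_range]
    simp [Λ, coeff_polySlice]
  refine Module.Finite.of_injective (ρ.codRestrict (LinearMap.range Λ) hρ) ?_
  intro X Y h
  refine Subtype.ext (ext_on fun p hp => ?_)
  exact congrFun (congrArg Subtype.val h) ⟨p, hp⟩

/-- A Lie algebra of fields `F(y) ∂_x + P(x, y) ∂_z` with polynomials of bounded degree is
nilpotent: brackets have no `∂_x`-component, and bracketing lowers the degree in `x`. -/
theorem isNilpotent_of_forall_isPoly {g : LieSubalgebra ℝ (VF U)} {N : ℕ}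
    (h : ∀ X ∈ g, ∃ F P, (∀ i, N ≤ i → P.coeff i = 0) ∧ IsPoly F P X) :
    LieRing.IsNilpotent g := by
  let M : ℕ → Submodule ℝ g := fun k =>
    { carrier := {X | ∃ F P, (1 ≤ k → F = 0) ∧ (∀ i, N ≤ i + k → P.coeff i = 0) ∧ IsPoly F P X.1}
      add_mem' := by
        rintro X Y ⟨F, P, hF, hP, hX⟩ ⟨G, Q, hG, hQ, hY⟩
        exact ⟨_, _, fun hk => by rw [hF hk, hG hk, add_zero], fun i hi => by
          rw [Polynomial.coeff_add, hP i hi, hQ i hi, add_zero], hX.add hY⟩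
      zero_mem' := ⟨0, 0, fun _ => rfl, fun _ _ => rfl, IsPoly.zero⟩
      smul_mem' := by
        rintro c X ⟨F, P, hF, hP, hX⟩
        exact ⟨_, _, fun hk => by rw [hF hk, smul_zero], fun i hi => by
          rw [Polynomial.coeff_smul, hP i hi, smul_zero], hX.smul c⟩ }
  have hM : ∀ k, (LieModule.lowerCentralSeries ℝ g g k).toSubmodule ≤ M k := by
    intro k
    induction k with
    | zero =>
      rintro X -
      obtain ⟨F, P, hP, hX⟩ := h X.1 X.2
      exact ⟨F, P, fun hk => by omega, hP, hX⟩
    | succ k ih =>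
      rw [LieModule.lowerCentralSeries_succ, LieSubmodule.lieIdeal_oper_eq_linear_span',
        Submodule.span_le]
      rintro _ ⟨Y, -, X, hX, rfl⟩
      obtain ⟨F, P, hF, hP, hXP⟩ := ih hX
      obtain ⟨G, Q, hQ, hYQ⟩ := h Y.1 Y.2
      refine ⟨0, _, fun _ => rfl, fun i hi => ?_, hYQ.bracket hXP⟩
      rw [Polynomial.coeff_sub, Polynomial.coeff_C_mul, Polynomial.coeff_C_mul,
        Polynomial.coeff_derivative, Polynomial.coeff_derivative, hP (i + 1) (by omega)]
      rcases Nat.eq_zero_or_pos k with rfl | hk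
      · rw [hQ (i + 1) (by omega)]; simp
      · rw [hF hk]; simp
  refine (LieModule.isNilpotent_iff ℝ g g).2 ⟨N + 1, (LieSubmodule.eq_bot_iff _).2 fun X hX => ?_⟩
  obtain ⟨F, P, hF, hP, hXP⟩ := hM _ hX
  refine Subtype.ext (ext_on fun p hp => ?_)
  have hP0 : P = 0 := Polynomial.ext fun i => by rw [hP i (by omega)]; rfl
  rw [hXP p hp, hF (by omega), hP0]
  exact (IsPoly.zero p hp).symm

end VF

/-! ### The algebra generated by the lifts and the vertical fields -/

namespace VF

variable {U : TopologicalSpace.Opens R3}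

theorem generated_le {m n : ℕ} {f : Fin m → ℝ → ℝ} {h : Fin m → Polynomial (ℝ → ℝ)}
    {g : Fin n → Polynomial (ℝ → ℝ)} (hf : ∀ i, ContDiffOn ℝ ∞ (f i) (yRange (U : Set R3)))
    (hh : ∀ i, SmoothCoeffs (yRange (U : Set R3)) (h i))
    (hg : ∀ j, SmoothCoeffs (yRange (U : Set R3)) (g j)) {A : Submodule ℝ (ℝ → ℝ)}
    {S : ℕ → Submodule ℝ (ℝ → ℝ)} (hS : ∀ i, ∀ F ∈ A, ∀ c ∈ S (i + 1), F * c ∈ S i)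
    (h1A : 1 ∈ A) (hfA : ∀ i, f i ∈ A) (h1S : 1 ∈ S 0) (hhS : ∀ i, h i ∈ coeffSubmodule S)
    (hgS : ∀ j, g j ∈ coeffSubmodule S) : generated hf hh hg ≤ polySubalgebra U A S hS := by
  refine LieSubalgebra.lieSpan_le.2 ?_
  rintro X (((rfl | rfl) | ⟨i, rfl⟩) | ⟨j, rfl⟩)
  · exact ⟨1, h1A, 0, Submodule.zero_mem _, isPoly_dx⟩
  · refine ⟨0, A.zero_mem, 1, fun i => ?_, isPoly_dz⟩
    rw [Polynomial.coeff_one]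
    split_ifs with hi
    · rwa [hi]
    · exact (S i).zero_mem
  · exact ⟨_, hfA i, _, hhS i, isPoly_lift _ _⟩
  · exact ⟨0, A.zero_mem, _, hgS j, isPoly_vertical _⟩

section generated

variable {m n : ℕ} {f : Fin m → ℝ → ℝ} {h : Fin m → Polynomial (ℝ → ℝ)}
  {g : Fin n → Polynomial (ℝ → ℝ)} (hf : ∀ i, ContDiffOn ℝ ∞ (f i) (yRange (U : Set R3)))
  (hh : ∀ i, SmoothCoeffs (yRange (U : Set R3)) (h i))
  (hg : ∀ j, SmoothCoeffs (yRange (U : Set R3)) (g j))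

theorem dx_mem_generated : dx U ∈ generated hf hh hg :=
  LieSubalgebra.subset_lieSpan (Or.inl (Or.inl (Or.inl rfl)))

theorem dz_mem_generated : dz U ∈ generated hf hh hg :=
  LieSubalgebra.subset_lieSpan (Or.inl (Or.inl (Or.inr rfl)))

theorem lift_mem_generated (i : Fin m) : lift (hf i) (hh i) ∈ generated hf hh hg :=
  LieSubalgebra.subset_lieSpan (Or.inl (Or.inr ⟨i, rfl⟩))

theorem vertical_mem_generated (j : Fin n) : vertical (hg j) ∈ generated hf hh hg :=
  LieSubalgebra.subset_lieSpan (Or.inr ⟨j, rfl⟩)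

theorem exists_isPoly_of_mem_generated {X : VF U} (hX : X ∈ generated hf hh hg) :
    ∃ F ∈ Submodule.span ℝ (insert (1 : ℝ → ℝ) (Set.range f)), ∃ P, IsPoly F P X := by
  obtain ⟨F, hF, P, -, hP⟩ := generated_le hf hh hg
    (A := Submodule.span ℝ (insert (1 : ℝ → ℝ) (Set.range f))) (S := fun _ => ⊤)
    (fun _ _ _ _ _ => trivial) (Submodule.subset_span (Or.inl rfl))
    (fun i => Submodule.subset_span (Or.inr ⟨i, rfl⟩)) trivial (fun _ _ => trivial)
    (fun _ _ => trivial) hX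
  exact ⟨F, hF, P, hP⟩

theorem exists_forall_coeff_eq_zero {ι : Type*} [Finite ι] (P : ι → Polynomial (ℝ → ℝ)) :
    ∃ N, ∀ i k, N ≤ k → (P i).coeff k = 0 := by
  obtain ⟨N, hN⟩ := (Set.finite_range fun i => (P i).natDegree + 1).bddAbove
  refine ⟨N, fun i k hk => Polynomial.coeff_eq_zero_of_natDegree_lt ?_⟩
  have := hN ⟨i, rfl⟩
  exact (Nat.lt_succ_self _).trans_le (this.trans hk)

/-- A common bound for the degrees of the generators. -/
theorem exists_degree_bound (h : Fin m → Polynomial (ℝ → ℝ)) (g : Fin n → Polynomial (ℝ → ℝ)) :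
    ∃ N, 1 ≤ N ∧ (∀ i k, N ≤ k → (h i).coeff k = 0) ∧ ∀ j k, N ≤ k → (g j).coeff k = 0 := by
  obtain ⟨N₁, h₁⟩ := exists_forall_coeff_eq_zero h
  obtain ⟨N₂, h₂⟩ := exists_forall_coeff_eq_zero g
  exact ⟨N₁ + N₂ + 1, by omega, fun i k hk => h₁ i k (by omega), fun j k hk => h₂ j k (by omega)⟩

theorem isNilpotent_generated : LieRing.IsNilpotent (generated hf hh hg) := by
  obtain ⟨N, hN, hhN, hgN⟩ := exists_degree_bound h g
  refine isNilpotent_of_forall_isPoly (N := N) fun X hX => ?_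
  have hmem : ∀ P : Polynomial (ℝ → ℝ), (∀ k, N ≤ k → P.coeff k = 0) →
      P ∈ coeffSubmodule fun i => if i < N then ⊤ else ⊥ := by
    intro P hP i
    beta_reduce
    split_ifs with hi
    · trivial
    · exact hP i (not_lt.1 hi)
  obtain ⟨F, -, P, hP, hXP⟩ := generated_le hf hh hg (A := ⊤)
    (S := fun i => if i < N then ⊤ else ⊥) (by
      intro i F _ c hc
      by_cases hi : i + 1 < N
      · rw [if_pos (by omega)]; trivial
      · rw [if_neg hi, Submodule.mem_bot] at hc
        rw [hc, mul_zero]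
        exact Submodule.zero_mem _)
    trivial (fun _ => trivial) (by rw [if_pos (by omega)]; trivial) (fun i => hmem _ (hhN i))
    (fun j => hmem _ (hgN j)) hX
  refine ⟨F, P, fun i hi => ?_, hXP⟩
  have := hP i
  beta_reduce at this
  rwa [if_neg (not_lt.2 hi), Submodule.mem_bot] at this

/-- Let `A = span (1, f_i)`, let `C` be spanned by the coefficients of the generators, and let `N`
exceed their degrees. The fields whose coefficient at `x ^ i` lies in `A ^ (N - i) * C` form a
finite-dimensional Lie algebra: a bracket multiplies by an element of `A` and lowers the degree. -/
theorem finiteDimensional_generated : FiniteDimensional ℝ (generated hf hh hg) := by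
  obtain ⟨N, hN, hhN, hgN⟩ := exists_degree_bound h g
  set A := Submodule.span ℝ (insert (1 : ℝ → ℝ) (Set.range f)) with hA
  have h1A : (1 : ℝ → ℝ) ∈ A := Submodule.subset_span (Or.inl rfl)
  set C := Submodule.span ℝ (insert (1 : ℝ → ℝ)
    (Set.range (fun w : Fin m × Fin N => (h w.1).coeff w.2) ∪
      Set.range (fun w : Fin n × Fin N => (g w.1).coeff w.2))) with hC
  have hAfg : A.FG := Submodule.fg_span ((Set.finite_range f).insert _)
  have hCfg : C.FG := Submodule.fg_span
    (((Set.finite_range _).union (Set.finite_range _)).insert _)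
  have hCA : ∀ k, C ≤ A ^ k * C := fun k c hc => by
    have := Submodule.mul_mem_mul (Submodule.pow_mem_pow A h1A k) hc
    rwa [one_pow, one_mul] at this
  set S : ℕ → Submodule ℝ (ℝ → ℝ) := fun i => if i < N then A ^ (N - i) * C else ⊥ with hSdef
  have hSC : ∀ i < N, C ≤ S i := fun i hi => by
    simp only [hSdef, if_pos hi]
    exact hCA _
  have hS : ∀ i, ∀ F ∈ A, ∀ c ∈ S (i + 1), F * c ∈ S i := by
    intro i F hF c hc
    by_cases hi : i + 1 < N
    · simp only [hSdef] at hc ⊢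
      rw [if_pos hi] at hc
      rw [if_pos (by omega), show N - i = (N - (i + 1)) + 1 by omega, pow_succ', mul_assoc]
      exact Submodule.mul_mem_mul hF hc
    · simp only [hSdef, if_neg hi, Submodule.mem_bot] at hc
      rw [hc, mul_zero]
      exact Submodule.zero_mem _
  have hmem : ∀ P : Polynomial (ℝ → ℝ), (∀ k, N ≤ k → P.coeff k = 0) →
      (∀ k : Fin N, P.coeff k ∈ C) → P ∈ coeffSubmodule S := by
    intro P hP hPC i
    by_cases hi : i < N
    · exact hSC i hi (hPC ⟨i, hi⟩)
    · rw [hP i (not_lt.1 hi)]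
      exact Submodule.zero_mem _
  have hle := generated_le hf hh hg hS h1A (fun i => Submodule.subset_span (Or.inr ⟨i, rfl⟩))
    (hSC 0 hN (Submodule.subset_span (Or.inl rfl)))
    (fun i => hmem _ (hhN i) fun k => Submodule.subset_span (Or.inr (Or.inl ⟨(i, k), rfl⟩)))
    (fun j => hmem _ (hgN j) fun k => Submodule.subset_span (Or.inr (Or.inr ⟨(j, k), rfl⟩)))
  have : FiniteDimensional ℝ A := Module.Finite.iff_fg.2 hAfg
  have : ∀ i, FiniteDimensional ℝ (S i) := fun i => by
    refine Module.Finite.iff_fg.2 ?_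
    simp only [hSdef]
    split_ifs
    · exact (hAfg.pow _).mul hCfg
    · exact Submodule.fg_bot
  have := finiteDimensional_polySubalgebra (U := U) hS (N := N) fun i hi => if_neg (not_lt.2 hi)
  exact Submodule.finiteDimensional_of_le (S₂ := (polySubalgebra U A S hS).toSubmodule) hle

end generated

/-- A nonzero polynomial in `x` does not vanish on a nonempty open set of values of `x`. -/
theorem exists_mem_eval_ne_zero {R : Polynomial ℝ} (hR : R ≠ 0) {y : ℝ}
    (hy : y ∈ yRange (U : Set R3)) : ∃ p ∈ U, p.2.1 = y ∧ R.eval p.1 ≠ 0 := by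
  obtain ⟨p, hp, rfl⟩ := hy
  by_contra! hc
  have hcont : Continuous fun x : ℝ => ((x, p.2.1, p.2.2) : R3) := by fun_prop
  refine hR (Polynomial.eq_zero_of_infinite_isRoot R ((infinite_of_mem_nhds p.1
    (hcont.continuousAt.preimage_mem_nhds (U.isOpen.mem_nhds hp))).mono fun x hx => ?_))
  exact hc _ hx rfl

theorem exists_bracket_dx_ne_zero {F : ℝ → ℝ} {P : Polynomial (ℝ → ℝ)} {X : VF U}
    (hX : IsPoly F P X) (hP : PosDegree (yRange (U : Set R3)) P) : ⁅dx U, X⁆ ≠ 0 := by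
  obtain ⟨y, hy, h⟩ := posDegree_iff.1 hP
  obtain ⟨p, hp, rfl, hpe⟩ := exists_mem_eval_ne_zero h hy
  intro h0
  have h1 := isPoly_dx.bracket_apply hX hp
  rw [h0] at h1
  have h2 := congrArg (fun q : R3 => q.2.2) h1
  simp [polySlice] at h2
  exact hpe (by simpa [polySlice] using h2.symm)

section generated

variable {m n : ℕ} {f : Fin m → ℝ → ℝ} {h : Fin m → Polynomial (ℝ → ℝ)}
  {g : Fin n → Polynomial (ℝ → ℝ)} (hf : ∀ i, ContDiffOn ℝ ∞ (f i) (yRange (U : Set R3)))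
  (hh : ∀ i, SmoothCoeffs (yRange (U : Set R3)) (h i))
  (hg : ∀ j, SmoothCoeffs (yRange (U : Set R3)) (g j))

theorem isLieAbelian_iff_forall {g : LieSubalgebra ℝ (VF U)} :
    IsLieAbelian g ↔ ∀ X ∈ g, ∀ Y ∈ g, ⁅X, Y⁆ = 0 :=
  ⟨fun h X hX Y hY => congrArg Subtype.val (h.trivial ⟨X, hX⟩ ⟨Y, hY⟩),
    fun h => ⟨fun X Y => Subtype.ext (h X.1 X.2 Y.1 Y.2)⟩⟩

theorem not_isLieAbelian_generated_iff : ¬ IsLieAbelian (generated hf hh hg) ↔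
    (∃ i, PosDegree (yRange (U : Set R3)) (h i)) ∨ ∃ j, PosDegree (yRange (U : Set R3)) (g j) := by
  constructor
  · intro hab
    by_contra! hc
    have hmem : ∀ P : Polynomial (ℝ → ℝ), ¬ PosDegree (yRange (U : Set R3)) P →
        ∀ i y, 1 ≤ i → y ∈ yRange (U : Set R3) → P.coeff i y = 0 := by
      intro P hP i y hi hy
      by_contra h0
      exact hP ⟨i, hi, y, hy, h0⟩
    let S : ℕ → Submodule ℝ (ℝ → ℝ) := fun i =>
      { carrier := {c | ∀ y, 1 ≤ i → y ∈ yRange (U : Set R3) → c y = 0}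
        add_mem' := fun ha hb y hi hy => by simp [ha y hi hy, hb y hi hy]
        zero_mem' := fun _ _ _ => rfl
        smul_mem' := fun c a ha y hi hy => by simp [ha y hi hy] }
    have hle := generated_le hf hh hg (A := ⊤) (S := S)
      (fun i F _ c hc y _ hy => by simp [hc y (by omega) hy]) trivial (fun _ => trivial)
      (fun y hi => by omega) (fun i k y => hmem _ (hc.1 i) k y) (fun j k y => hmem _ (hc.2 j) k y)
    have hder : ∀ P ∈ coeffSubmodule S, ∀ p ∈ U, (polySlice P p.2.1).derivative = 0 := by
      intro P hP p hp
      ext i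
      rw [Polynomial.coeff_derivative, coeff_polySlice, hP (i + 1) p.2.1 (by omega) ⟨p, hp, rfl⟩]
      simp
    refine hab (isLieAbelian_iff_forall.2 fun X hX Y hY => ext_on fun p hp => ?_)
    obtain ⟨F, -, P, hP, hXP⟩ := hle hX
    obtain ⟨G, -, Q, hQ, hYQ⟩ := hle hY
    rw [hXP.bracket_apply hYQ hp, hder P hP p hp, hder Q hQ p hp]
    simp
  · intro hpos hab
    rw [isLieAbelian_iff_forall] at hab
    rcases hpos with ⟨i, hi⟩ | ⟨j, hj⟩
    · exact exists_bracket_dx_ne_zero (isPoly_lift _ _) hi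
        (hab _ (dx_mem_generated hf hh hg) _ (lift_mem_generated hf hh hg i))
    · exact exists_bracket_dx_ne_zero (isPoly_vertical _) hj
        (hab _ (dx_mem_generated hf hh hg) _ (vertical_mem_generated hf hh hg j))

/-- Fields `κ(y) ∂_z` commute with every field `F(y) ∂_x + P(x, y) ∂_z`. -/
theorem mem_center_generated {X : VF U} (hX : X ∈ generated hf hh hg) {κ : ℝ → ℝ}
    (hκ : ∀ p ∈ U, X.1 p = (0, 0, κ p.2.1)) : X ∈ center (generated hf hh hg) := by
  refine mem_center_iff.2 ⟨hX, fun Y hY => ext_on fun p hp => ?_⟩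
  obtain ⟨G, -, Q, hYQ⟩ := exists_isPoly_of_mem_generated hf hh hg hY
  have hXκ : IsPoly 0 (Polynomial.C κ) X := fun p hp => by
    rw [hκ p hp]
    simp [polyEval_eq_eval_polySlice, polySlice]
  rw [hYQ.bracket_apply hXκ hp]
  simp [polySlice]

/-- A nonconstant coefficient `κ` with `κ(y) ∂_z` in the algebra gives, with `∂_z`, two independent
central elements. -/
theorem two_le_finrank_center {X : VF U} (hX : X ∈ generated hf hh hg) {κ : ℝ → ℝ}
    (hκ : ∀ p ∈ U, X.1 p = (0, 0, κ p.2.1)) (hnc : NonconstantOn (yRange (U : Set R3)) κ) :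
    2 ≤ Module.finrank ℝ (center (generated hf hh hg)) := by
  have hdz : ∀ p ∈ U, (dz U).1 p = (0, 0, 1) := fun p hp => ofFun_apply _ _ hp
  have hXc := mem_center_generated hf hh hg hX hκ
  have hdzc := mem_center_generated hf hh hg (dz_mem_generated hf hh hg) (κ := 1) hdz
  have := finiteDimensional_generated hf hh hg
  have : FiniteDimensional ℝ (center (generated hf hh hg)) :=
    Module.Finite.map _ _
  have hli : LinearIndependent ℝ ![(⟨dz U, hdzc⟩ : center (generated hf hh hg)), ⟨X, hXc⟩] := by
    refine LinearIndependent.pair_iff.2 fun s t hst => ?_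
    obtain ⟨y, ⟨p, hp, rfl⟩, y', ⟨p', hp', rfl⟩, hne⟩ := hnc
    have hval : ∀ q ∈ U, s + t * κ q.2.1 = 0 := by
      intro q hq
      have h1 : s • (dz U).1 q + t • X.1 q = 0 := congrFun (congrArg (fun w => w.1.1) hst) q
      rw [hdz q hq, hκ q hq] at h1
      simpa using congrArg (fun w : R3 => w.2.2) h1
    have e := hval p hp
    have e' := hval p' hp'
    have ht : t = 0 := by
      have : t * (κ p.2.1 - κ p'.2.1) = 0 := by linear_combination e - e'
      exact (mul_eq_zero.1 this).resolve_right (sub_ne_zero.2 hne)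
    subst ht
    exact ⟨by simpa using e, rfl⟩
  simpa using hli.fintype_card_le_finrank

/-- The iterated brackets of `∂_x` with `g_j ∂_z`. -/
theorem exists_isPoly_iterate_derivative (j : Fin n) (k : ℕ) :
    ∃ X ∈ generated hf hh hg, IsPoly 0 (Polynomial.derivative^[k] (g j)) X := by
  induction k with
  | zero => exact ⟨_, vertical_mem_generated hf hh hg j, isPoly_vertical _⟩
  | succ k ih =>
    obtain ⟨X, hX, hXP⟩ := ih
    refine ⟨⁅dx U, X⁆, (generated hf hh hg).lie_mem (dx_mem_generated hf hh hg) hX, ?_⟩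
    have := isPoly_dx.bracket hXP
    simpa [Function.iterate_succ_apply'] using this

theorem two_le_finrank_center_generated
    (hpos : ∃ j, PosDegree (yRange (U : Set R3)) (g j))
    (hnc : (∃ i, NonconstantOn (yRange (U : Set R3)) (f i)) ∨
      ∃ j, NonconstantLeadingCoeff (yRange (U : Set R3)) (g j)) :
    2 ≤ Module.finrank ℝ (center (generated hf hh hg)) := by
  -- `∂_x ^ k` turns the polynomial of degree `k` into `k!` times its leading coefficient
  have hlead : ∀ j, NonconstantLeadingCoeff (yRange (U : Set R3)) (g j) →
      2 ≤ Module.finrank ℝ (center (generated hf hh hg)) := by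
    rintro j ⟨k, hk, y, hy, y', hy', hne⟩
    obtain ⟨X, hX, hXP⟩ := exists_isPoly_iterate_derivative hf hh hg j k
    refine two_le_finrank_center hf hh hg hX (κ := fun y => k.factorial * (g j).coeff k y)
      (fun p hp => ?_) ⟨y, hy, y', hy', fun h => hne ?_⟩
    · rw [hXP p hp, polyEval_eq_eval_polySlice,
        polySlice_iterate_derivative fun l hl => hk l hl _ ⟨p, hp, rfl⟩, Polynomial.eval_C]
      rfl
    · exact mul_left_cancel₀ (Nat.cast_ne_zero.2 k.factorial_ne_zero) h
  rcases hnc with ⟨i, y, hy, y', hy', hne⟩ | ⟨j, hj⟩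
  · obtain ⟨j, hj⟩ := hpos
    obtain ⟨k, hk1, ⟨y₀, hy₀, hc⟩, hk⟩ := hj.exists_leading
    by_cases hnc : NonconstantOn (yRange (U : Set R3)) ((g j).coeff k)
    · exact hlead j ⟨k, hk, hnc⟩
    -- if the leading coefficient is constant, the last `∂_x` is replaced by `f_i ∂_x + h_i ∂_z`
    · have hconst : ∀ y ∈ yRange (U : Set R3), (g j).coeff k y = (g j).coeff k y₀ := by
        intro y hy
        by_contra h
        exact hnc ⟨y, hy, y₀, hy₀, h⟩
      obtain ⟨k, rfl⟩ : ∃ l, k = l + 1 := ⟨k - 1, by omega⟩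
      obtain ⟨X, hX, hXP⟩ := exists_isPoly_iterate_derivative hf hh hg j k
      refine two_le_finrank_center hf hh hg ((generated hf hh hg).lie_mem
        (lift_mem_generated hf hh hg i) hX)
        (κ := fun y => f i y * ((k + 1).factorial * (g j).coeff (k + 1) y₀))
        (fun p hp => ?_) ⟨y, hy, y', hy', fun h => hne ?_⟩
      · have h1 := polySlice_iterate_derivative (P := g j) (k := k + 1) (y := p.2.1)
          fun l hl => hk l hl _ ⟨p, hp, rfl⟩
        rw [(isPoly_lift (hf i) (hh i)).bracket_apply hXP hp, ← hconst _ ⟨p, hp, rfl⟩]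
        rw [Function.iterate_succ_apply', polySlice, ← Polynomial.derivative_map] at h1
        rw [polySlice, h1]
        simp
      · exact mul_right_cancel₀ (mul_ne_zero (Nat.cast_ne_zero.2 (Nat.factorial_ne_zero _)) hc) h
  · exact hlead j hj

/-- A central element commutes with `∂_x`, so `P` is constant in `x`. As some element of the
algebra does depend on `x`, its `∂_x`-component vanishes on an open set, hence everywhere. -/
theorem exists_eq_of_mem_center_generated (hab : ¬ IsLieAbelian (generated hf hh hg))
    (hspan : ∀ F ∈ Submodule.span ℝ (insert (1 : ℝ → ℝ) (Set.range f)),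
      ∀ W : Set ℝ, IsOpen W → W.Nonempty → W ⊆ yRange (U : Set R3) →
        (∀ y ∈ W, F y = 0) → ∀ y ∈ yRange (U : Set R3), F y = 0)
    {X : VF U} (hX : X ∈ center (generated hf hh hg)) :
    ∃ k : ℝ → ℝ, ContDiffOn ℝ ∞ k (yRange (U : Set R3)) ∧ ∀ p ∈ U, X.1 p = (0, 0, k p.2.1) := by
  obtain ⟨hXg, hXc⟩ := mem_center_iff.1 hX
  obtain ⟨F, hF, P, hXP⟩ := exists_isPoly_of_mem_generated hf hh hg hXg
  have hP0 : ∀ p ∈ U, (polySlice P p.2.1).derivative.eval p.1 = 0 := by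
    intro p hp
    have h1 := isPoly_dx.bracket_apply hXP hp
    rw [hXc _ (dx_mem_generated hf hh hg)] at h1
    have h2 := congrArg (fun q : R3 => q.2.2) h1
    simpa [polySlice] using h2.symm
  have hPC : ∀ y ∈ yRange (U : Set R3), polySlice P y = Polynomial.C (P.coeff 0 y) := by
    intro y hy
    have h1 : (polySlice P y).derivative = 0 := by
      by_contra h
      obtain ⟨p, hp, rfl, hpe⟩ := exists_mem_eval_ne_zero h hy
      exact hpe (hP0 p hp)
    rw [← coeff_polySlice]
    exact Polynomial.eq_C_of_natDegree_eq_zero (Polynomial.derivative_eq_zero.1 h1)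
  obtain ⟨Y, hY, p₁, hp₁, hne⟩ : ∃ Y ∈ generated hf hh hg, ∃ p ∈ U, (⁅dx U, Y⁆ : VF U).1 p ≠ 0 := by
    by_contra! hc
    have hder : ∀ Y ∈ generated hf hh hg, ∀ G Q, IsPoly G Q Y → ∀ p ∈ U,
        (polySlice Q p.2.1).derivative.eval p.1 = 0 := by
      intro Y hY G Q hYQ p hp
      have h1 := isPoly_dx.bracket_apply hYQ hp
      rw [hc Y hY p hp] at h1
      have h2 := congrArg (fun q : R3 => q.2.2) h1
      simpa [polySlice] using h2.symm
    refine hab (isLieAbelian_iff_forall.2 fun X hX Y hY => ext_on fun p hp => ?_)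
    obtain ⟨F, -, P, hXP⟩ := exists_isPoly_of_mem_generated hf hh hg hX
    obtain ⟨G, -, Q, hYQ⟩ := exists_isPoly_of_mem_generated hf hh hg hY
    rw [hXP.bracket_apply hYQ hp, hder X hX F P hXP p hp, hder Y hY G Q hYQ p hp]
    simp
  obtain ⟨G, -, Q, hYQ⟩ := exists_isPoly_of_mem_generated hf hh hg hY
  set O : Set R3 := U ∩ (⁅dx U, Y⁆ : VF U).1 ⁻¹' {0}ᶜ with hO
  have hOo : IsOpen O := (⁅dx U, Y⁆ : VF U).2.1.continuousOn.isOpen_inter_preimage U.isOpen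
    isOpen_compl_singleton
  have hFO : ∀ y ∈ yRange O, F y = 0 := by
    rintro _ ⟨p, ⟨hp, hpne⟩, rfl⟩
    have h1 := hYQ.bracket_apply hXP hp
    rw [hXc Y hY, hP0 p hp] at h1
    have h2 := congrArg (fun q : R3 => q.2.2) h1
    have h3 : F p.2.1 * (polySlice Q p.2.1).derivative.eval p.1 = 0 := by simpa using h2
    refine (mul_eq_zero.1 h3).resolve_right fun h4 => hpne ?_
    change (⁅dx U, Y⁆ : VF U).1 p = 0
    rw [isPoly_dx.bracket_apply hYQ hp, h4]
    simp [polySlice]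
  have hF0 := hspan F hF (yRange O)
    ((isOpenMap_fst.comp isOpenMap_snd) O hOo) ⟨_, p₁, ⟨hp₁, hne⟩, rfl⟩
    (Set.image_mono Set.inter_subset_left) hFO
  have hXk : ∀ p ∈ U, X.1 p = (0, 0, P.coeff 0 p.2.1) := by
    intro p hp
    have hy : p.2.1 ∈ yRange (U : Set R3) := ⟨p, hp, rfl⟩
    rw [hXP p hp, hF0 _ hy, polyEval_eq_eval_polySlice, hPC _ hy, Polynomial.eval_C]
  refine ⟨P.coeff 0, ?_, hXk⟩
  -- the coefficient is a component of `X` along a segment parallel to the `y`-axis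
  rintro _ ⟨p, hp, rfl⟩
  have hline : ContDiff ℝ ∞ fun y : ℝ => ((p.1, y, p.2.2) : R3) := by fun_prop
  have h1 : ContDiffAt ℝ ∞ (fun y : ℝ => (X.1 (p.1, y, p.2.2)).2.2) p.2.1 :=
    (contDiff_snd.comp contDiff_snd).contDiffAt.comp p.2.1
      (ContDiffAt.comp p.2.1 (X.contDiffAt hp) hline.contDiffAt)
  refine (h1.congr_of_eventuallyEq ?_).contDiffWithinAt
  filter_upwards [hline.continuous.continuousAt.preimage_mem_nhds (U.isOpen.mem_nhds hp)] with y hy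
  rw [hXk _ hy]

theorem rank_center_generated_eq_one (hab : ¬ IsLieAbelian (generated hf hh hg))
    (hc : ∀ X ∈ center (generated hf hh hg), ∃ k : ℝ → ℝ,
      ContDiffOn ℝ ∞ k (yRange (U : Set R3)) ∧ ∀ p ∈ U, X.1 p = (0, 0, k p.2.1)) :
    rank (center (generated hf hh hg)) = 1 := by
  have hdz : ∀ p ∈ U, (dz U).1 p = (0, 0, 1) := fun p hp => ofFun_apply _ _ hp
  have hdzc := mem_center_generated hf hh hg (dz_mem_generated hf hh hg) (κ := 1) hdz
  obtain ⟨p₀, hp₀⟩ : ∃ p, p ∈ U := by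
    by_contra! hU
    exact hab (isLieAbelian_iff_forall.2 fun X _ Y _ => ext_on fun p hp => (hU p hp).elim)
  have : Nonempty U := ⟨⟨p₀, hp₀⟩⟩
  have hmap : ∀ p : U, (center (generated hf hh hg)).map (evalAt p.1) =
      Submodule.span ℝ {((0, 0, 1) : R3)} := by
    intro p
    apply le_antisymm
    · rintro _ ⟨X, hX, rfl⟩
      obtain ⟨k, -, hk⟩ := hc X hX
      refine Submodule.mem_span_singleton.2 ⟨k p.1.2.1, ?_⟩
      change _ = X.1 p.1
      rw [hk p.1 p.2]
      simp
    · rw [Submodule.span_singleton_le_iff_mem]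
      exact ⟨dz U, hdzc, hdz p.1 p.2⟩
  have h1 : ∀ p : U, Module.finrank ℝ ((center (generated hf hh hg)).map (evalAt p.1)) = 1 := by
    intro p
    rw [hmap p]
    exact finrank_span_singleton (by simp)
  rw [rank, iSup_congr h1, ciSup_const]

end generated

end VF

theorem theorem2 :
    -- (a): normal form
    (∀ (U : TopologicalSpace.Opens R3) (g : LieSubalgebra ℝ (VF U)),
      FiniteDimensional ℝ g → LieRing.IsNilpotent g → ¬ IsLieAbelian g → VF.LocallyFaithful g →
      VF.rank (VF.center g) = 1 → 2 ≤ Module.finrank ℝ (VF.center g) →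
      ∀ W : Set R3, IsOpen W → W.Nonempty → W ⊆ U →
        ∃ φ : OpenPartialHomeomorph R3 R3, IsSmoothChart φ ∧ φ.source.Nonempty ∧ φ.source ⊆ W ∧
          (∀ X ∈ g, ∃ Y : R3 → R3, IsTriangularOn φ.target Y ∧ VF.HasExpression φ X Y) ∧
          (∃ X ∈ g, VF.HasExpression φ X (fun _ => (1, 0, 0))) ∧
          (∃ X ∈ VF.center g, VF.HasExpression φ X (fun _ => (0, 0, 1)))) ∧
    -- (b), (c): construction
    (∀ (U : TopologicalSpace.Opens R3) (m n : ℕ) (f : Fin m → ℝ → ℝ)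
      (h : Fin m → Polynomial (ℝ → ℝ)) (g : Fin n → Polynomial (ℝ → ℝ))
      (hf : ∀ i, ContDiffOn ℝ ∞ (f i) (yRange (U : Set R3)))
      (hh : ∀ i, SmoothCoeffs (yRange (U : Set R3)) (h i))
      (hg : ∀ j, SmoothCoeffs (yRange (U : Set R3)) (g j)),
      FiniteDimensional ℝ (VF.generated hf hh hg) ∧
      LieRing.IsNilpotent (VF.generated hf hh hg) ∧
      (¬ IsLieAbelian (VF.generated hf hh hg) ↔
        (∃ i, PosDegree (yRange (U : Set R3)) (h i)) ∨
          ∃ j, PosDegree (yRange (U : Set R3)) (g j)) ∧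
      ((∃ j, PosDegree (yRange (U : Set R3)) (g j)) →
        ((∃ i, NonconstantOn (yRange (U : Set R3)) (f i)) ∨
          ∃ j, NonconstantLeadingCoeff (yRange (U : Set R3)) (g j)) →
        2 ≤ Module.finrank ℝ (VF.center (VF.generated hf hh hg))) ∧
      (¬ IsLieAbelian (VF.generated hf hh hg) →
        (∀ F ∈ Submodule.span ℝ (insert (1 : ℝ → ℝ) (Set.range f)),
          ∀ W : Set ℝ, IsOpen W → W.Nonempty → W ⊆ yRange (U : Set R3) →
            (∀ y ∈ W, F y = 0) → ∀ y ∈ yRange (U : Set R3), F y = 0) →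
        VF.rank (VF.center (VF.generated hf hh hg)) = 1 ∧
        ∀ X ∈ VF.center (VF.generated hf hh hg),
          ∃ k : ℝ → ℝ, ContDiffOn ℝ ∞ k (yRange (U : Set R3)) ∧
            ∀ p ∈ U, X.1 p = (0, 0, k p.2.1))) := by

  refine ⟨fun U g _ hnil hab hloc hrank hdim W hW hWne hWU =>
      VF.exists_triangular_chart g hnil hab hloc hrank hdim hW hWne hWU,
    fun U m n f h g hf hh hg => ⟨VF.finiteDimensional_generated hf hh hg,
      VF.isNilpotent_generated hf hh hg, VF.not_isLieAbelian_generated_iff hf hh hg,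
      VF.two_le_finrank_center_generated hf hh hg, fun hab hspan => ?_⟩⟩
  have hc := fun X hX => VF.exists_eq_of_mem_center_generated hf hh hg hab hspan (X := X) hX
  exact ⟨VF.rank_center_generated_eq_one hf hh hg hab hc, hc⟩
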